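/- Let $\Omega\subset\mathbb R^3$ be a bounded Lipschitz domain and let $\mathcal T$ be a finite, geometrically conforming mesh of nondegenerate tetrahedra with $\bigcup_{T\in\mathcal T}T=\overline\Omega$. Let $p\ge 0$ be an integer, $\Delta t>0$, $\tau^\star>0$, and for each $T\in\mathcal T$ let $F^\star_T$ be an arbitrary face of $T$. Write $\mathcal P_k$ for the polynomials of total degree at most $k$ (with $\mathcal P_{-1}=\{0\}$), $\nu$ for the outward unit normal of $T$, $(\cdot,\cdot)_T$ for the $L^2(T)$ inner product of scalar, vector or matrix fields, $\langle\!\langle\cdot,\cdot\rangle\!\rangle_{\partial T}$ for the $L^2(\partial T)$ inner product, $(\cdot,\cdot)=\sum_T(\cdot,\cdot)_T$ and $\langle\!\langle\cdot,\cdot\rangle\!\rangle=\sum_T\langle\!\langle\cdot,\cdot\rangle\!\rangle_{\partial T}$. The divergence $\nabla\cdot G$ of a matrix field is taken row by row. Let $M$ be the space of all $\lambda\in[L^2(\Sigma)]^3$ on the skeleton $\Sigma$ (the union of all faces) such that $\lambda|_F\in[\mathcal P_p(F)]^3$ for every face $F$ and $\lambda|_F=0$ for every face $F\subset\partial\Omega$.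 Consider the following three methods, each given by local spaces $W_T,V_T,Q_T$ and a stabilization function $\tau$ on $\partial T$: - SFH: $W_T=[\mathcal P_p]^{3\times3}$, $V_T=[\mathcal P_p]^3$, $Q_T=\mathcal P_p$, and $\tau=\tau^\star$ on $F_T^\star$, $\tau=0$ on $\partial T\setminus F^\star_T$; - RT-H: $W_T$ consists of the matrix fields whose three rows belong to the Raviart--Thomas space $[\mathcal P_p]^3+x\,\mathcal P_p$, $V_T=[\mathcal P_p]^3$, $Q_T=\mathcal P_p$, and $\tau=0$; - BDM-H: $W_T=[\mathcal P_p]^{3\times3}$, $V_T=[\mathcal P_{p-1}]^3$, $Q_T=\mathcal P_p$, and $\tau=0$. Then for each of the three methods, each $\lambda\in M$ and each $T\in\mathcal T$, there is exactly one $(L\lambda,u\lambda,p\lambda)\in W_T\times V_T\times Q_T$ such that, for all $(G,v,q)\in W_T\times V_T\times Q_T$, $$(L\lambda,G)_T+(u\lambda,\nabla\cdot G)_T=\langle\!\langle\lambda,G\nu\rangle\!\rangle_{\partial T},$$ $$(-\nabla\cdot L\lambda+\nabla p\lambda,v)_T+\langle\!\langle\tau(u\lambda-\lambda),v\rangle\!\rangle_{\partial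 T}=0,$$ $$\tfrac1{\Delta t}(p\lambda,q)_T-(u\lambda,\nabla q)_T=-\langle\!\langle\lambda\cdot\nu,q\rangle\!\rangle_{\partial T}.$$ With the condensed augmented Lagrangian bilinear form of each method, $$a(\lambda,\mu)=(L\lambda,L\mu)+\langle\!\langle\tau(u\lambda-\lambda),u\mu-\mu\rangle\!\rangle+\tfrac1{\Delta t}(p\lambda,p\mu),$$ one has for all $\lambda,\mu\in M$ $$a_{\mathrm{BDM}}(\lambda,\mu)=a_{\mathrm{RT}}(\lambda,\mu)=a_{\mathrm{SFH}}(\lambda,\mu).$$ Moreover, on every cell $L_{\mathrm{BDM}}\lambda=L_{\mathrm{RT}}\lambda=L_{\mathrm{SFH}}\lambda$ and $p_{\mathrm{BDM}}\lambda=p_{\mathrm{RT}}\lambda=p_{\mathrm{SFH}}\lambda$, and the stabilization term $\langle\!\langle\tau(u\lambda-\lambda),u\mu-\mu\rangle\!\rangle$ is zero for each of the three methods. -/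

import Mathlib

open MeasureTheory

noncomputable section

namespace StokesHDG

/-- Three-dimensional Euclidean space. -/
abbrev E3 : Type := EuclideanSpace ℝ (Fin 3)

/-- Real polynomials in the three Cartesian coordinates. On a nondegenerate tetrahedron a polynomial
function and its polynomial determine each other. -/
abbrev Poly3 : Type := MvPolynomial (Fin 3) ℝ

/-! ### Meshes -/

/-- A finite, geometrically conforming tetrahedral mesh of `Ω`: a finite simplicial complex all of
whose simplices are faces of tetrahedra of the complex and whose tetrahedra cover the closure
of `Ω`. A simplex is represented by the finite set of its vertices. -/
structure TetMesh (Ω : Set E3) where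
  complex : Geometry.SimplicialComplex ℝ E3
  finite : complex.faces.Finite
  pure : ∀ s ∈ complex.faces, ∃ t ∈ complex.faces, s ⊆ t ∧ t.card = 4
  closure_eq : closure Ω = complex.space

/-- The closed simplex with the given vertices. -/
def hull (s : Finset E3) : Set E3 := convexHull ℝ (s : Set E3)

/-- The cells (tetrahedra) of a mesh. -/
def TetMesh.cells {Ω : Set E3} (mesh : TetMesh Ω) : Finset (Finset E3) :=
  mesh.finite.toFinset.filter fun T => T.card = 4

/-- The (two-dimensional, triangular) faces of a mesh. -/
def TetMesh.faces {Ω : Set E3} (mesh : TetMesh Ω) : Finset (Finset E3) :=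
  mesh.finite.toFinset.filter fun F => F.card = 3

/-- The Dirichlet faces: the faces that lie on the boundary of `Ω`. -/
def TetMesh.IsDirichlet {Ω : Set E3} (_mesh : TetMesh Ω) (F : Finset E3) : Prop :=
  hull F ⊆ frontier Ω

/-- The skeleton: the union of all faces. -/
def TetMesh.skeleton {Ω : Set E3} (mesh : TetMesh Ω) : Set E3 :=
  ⋃ F ∈ mesh.faces, hull F

/-- The four triangular faces of a single cell; `∂T` is their union. -/
def facesOf (T : Finset E3) : Finset (Finset E3) := T.powersetCard 3

/-- The barycenter of a simplex. -/
def barycenter (s : Finset E3) : E3 := (s.card : ℝ)⁻¹ • ∑ v ∈ s, v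

/-- The component orthogonal to the plane of `F` of the vector that points from the barycenter of
the cell `T` to the barycenter of its face `F`. -/
def normalDir (T F : Finset E3) : E3 :=
  ((vectorSpan ℝ (F : Set E3))ᗮ).starProjection (barycenter F - barycenter T)

/-- The unit normal on the face `F` of the cell `T` that points out of `T`. -/
def outerNormal (T F : Finset E3) : E3 := ‖normalDir T F‖⁻¹ • normalDir T F

/-- The surface measure: two-dimensional Hausdorff measure, normalized so that it is the Lebesgue
measure on planes. -/
def surfaceMeasure : Measure E3 := μHE[2]

/-! ### Polynomials and polynomial spaces -/

/-- The value of a polynomial at a point. -/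
def pval (q : Poly3) (x : E3) : ℝ := MvPolynomial.eval (fun i => x i) q

/-- The gradient of a polynomial. -/
def grad (q : Poly3) : Fin 3 → Poly3 := fun i => MvPolynomial.pderiv i q

/-- The row-wise divergence of a matrix-valued polynomial. -/
def divergence (G : Matrix (Fin 3) (Fin 3) Poly3) : Fin 3 → Poly3 :=
  fun i => ∑ j, MvPolynomial.pderiv j (G i j)

/-- Polynomials of total degree at most `k`; this is the zero space for `k < 0`. -/
def polySpace (k : ℤ) : Submodule ℝ Poly3 :=
  MvPolynomial.restrictSupport ℝ {n : Fin 3 →₀ ℕ | (n.degree : ℤ) ≤ k}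

/-- Vector fields whose three components are polynomials of degree at most `k`. -/
def vecPolySpace (k : ℤ) : Submodule ℝ (Fin 3 → Poly3) :=
  Submodule.pi Set.univ fun _ => polySpace k

/-- Matrix fields all of whose rows belong to a given space of vector fields. -/
def rowwise (R : Submodule ℝ (Fin 3 → Poly3)) :
    Submodule ℝ (Matrix (Fin 3) (Fin 3) Poly3) where
  carrier := {G | ∀ i, G i ∈ R}
  add_mem' hG hH i := R.add_mem (hG i) (hH i)
  zero_mem' _ := R.zero_mem
  smul_mem' c _ hG i := R.smul_mem c (hG i)

/-- The Raviart--Thomas space `[P_p]³ + x P_p`. -/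
def raviartThomas (p : ℕ) : Submodule ℝ (Fin 3 → Poly3) :=
  vecPolySpace p ⊔
    (polySpace p).map (LinearMap.pi fun j => LinearMap.mulLeft ℝ (MvPolynomial.X j : Poly3))

/-! ### The trace space -/

/-- The space `M` of traces: the square integrable vector fields on the skeleton that are polynomial
of degree at most `p` on each face and vanish on the Dirichlet faces. -/
def traceSpace {Ω : Set E3} (mesh : TetMesh Ω) (p : ℕ) :
    Submodule ℝ (Lp E3 2 (surfaceMeasure.restrict mesh.skeleton)) where
  carrier := {lam |
    (∀ F ∈ mesh.faces, ∃ q ∈ vecPolySpace p,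
      ∀ᵐ x ∂(surfaceMeasure.restrict (hull F)), ∀ i, lam x i = pval (q i) x) ∧
    (∀ F ∈ mesh.faces, mesh.IsDirichlet F →
      ∀ᵐ x ∂(surfaceMeasure.restrict (hull F)), lam x = 0)}
  add_mem' := by
    rintro a b ⟨ha, ha'⟩ ⟨hb, hb'⟩
    have key : ∀ F ∈ mesh.faces, ∀ᵐ x ∂(surfaceMeasure.restrict (hull F)),
        (a + b : Lp E3 2 (surfaceMeasure.restrict mesh.skeleton)) x = a x + b x := fun F hF =>
      ae_restrict_of_ae_restrict_of_subset (Set.subset_biUnion_of_mem (u := hull) hF)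
        (Lp.coeFn_add a b)
    refine ⟨fun F hF => ?_, fun F hF hD => ?_⟩
    · obtain ⟨q, hq, h1⟩ := ha F hF
      obtain ⟨r, hr, h2⟩ := hb F hF
      refine ⟨q + r, Submodule.add_mem _ hq hr, ?_⟩
      filter_upwards [key F hF, h1, h2] with x h h1 h2 i
      rw [h]
      simp [h1 i, h2 i, pval]
    · filter_upwards [key F hF, ha' F hF hD, hb' F hF hD] with x h h1 h2
      rw [h, h1, h2, add_zero]
  zero_mem' := by
    have key : ∀ F ∈ mesh.faces, ∀ᵐ x ∂(surfaceMeasure.restrict (hull F)),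
        (0 : Lp E3 2 (surfaceMeasure.restrict mesh.skeleton)) x = 0 := fun F hF =>
      ae_restrict_of_ae_restrict_of_subset (Set.subset_biUnion_of_mem (u := hull) hF)
        (Lp.coeFn_zero E3 2 _)
    refine ⟨fun F hF => ⟨0, Submodule.zero_mem _, ?_⟩, fun F hF _ => key F hF⟩
    filter_upwards [key F hF] with x h i
    rw [h]
    simp [pval]
  smul_mem' := by
    rintro c a ⟨ha, ha'⟩
    have key : ∀ F ∈ mesh.faces, ∀ᵐ x ∂(surfaceMeasure.restrict (hull F)),
        (c • a : Lp E3 2 (surfaceMeasure.restrict mesh.skeleton)) x = c • a x := fun F hF =>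
      ae_restrict_of_ae_restrict_of_subset (Set.subset_biUnion_of_mem (u := hull) hF)
        (Lp.coeFn_smul c a)
    refine ⟨fun F hF => ?_, fun F hF hD => ?_⟩
    · obtain ⟨q, hq, h1⟩ := ha F hF
      refine ⟨c • q, Submodule.smul_mem _ c hq, ?_⟩
      filter_upwards [key F hF, h1] with x h h1 i
      simp [h, h1 i, pval]
    · filter_upwards [key F hF, ha' F hF hD] with x h h1
      simp [h, h1]

/-! ### The three methods -/

/-- A choice of local approximation spaces `W` (gradient), `V` (velocity), `Q` (pressure), the same
on every cell, and of the stabilization: `S = stab T F • 1` on the face `F` of the cell `T`. -/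
structure Method where
  W : Submodule ℝ (Matrix (Fin 3) (Fin 3) Poly3)
  V : Submodule ℝ (Fin 3 → Poly3)
  Q : Submodule ℝ Poly3
  stab : Finset E3 → Finset E3 → ℝ

open scoped Classical in
/-- The single face hybridizable method with stabilization parameter `τ` on the chosen face
`Fstar T` of each cell `T`, and `0` on the other faces. -/
def sfh (p : ℕ) (τ : ℝ) (Fstar : Finset E3 → Finset E3) : Method where
  W := rowwise (vecPolySpace p)
  V := vecPolySpace p
  Q := polySpace p
  stab T F := if F = Fstar T then τ else 0

/-- The hybrid Raviart--Thomas method. -/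
def rtH (p : ℕ) : Method where
  W := rowwise (raviartThomas p)
  V := vecPolySpace p
  Q := polySpace p
  stab _ _ := 0

/-- The hybrid Brezzi--Douglas--Marini method. -/
def bdmH (p : ℕ) : Method where
  W := rowwise (vecPolySpace p)
  V := vecPolySpace ((p : ℤ) - 1)
  Q := polySpace p
  stab _ _ := 0

/-! ### Local solvers -/

/-- A triple `(L, u, p)` of polynomial fields on a cell. -/
structure LocalTriple where
  L : Matrix (Fin 3) (Fin 3) Poly3
  u : Fin 3 → Poly3
  p : Poly3

instance : Nonempty LocalTriple := ⟨⟨0, 0, 0⟩⟩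

/-- `(p, q)_T` for scalar fields. -/
def innerS (T : Finset E3) (p q : Poly3) : ℝ := ∫ x in hull T, pval p x * pval q x

/-- `(u, v)_T` for vector fields. -/
def innerV (T : Finset E3) (u v : Fin 3 → Poly3) : ℝ :=
  ∫ x in hull T, ∑ i, pval (u i) x * pval (v i) x

/-- `(L, G)_T` for matrix fields. -/
def innerM (T : Finset E3) (L G : Matrix (Fin 3) (Fin 3) Poly3) : ℝ :=
  ∫ x in hull T, ∑ i, ∑ j, pval (L i j) x * pval (G i j) x

/-- `∫_{∂T} g dσ`, where the integrand may depend on the face, as the outer normal does. -/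
def boundaryIntegral (T : Finset E3) (g : Finset E3 → E3 → ℝ) : ℝ :=
  ∑ F ∈ facesOf T, ∫ x in hull F, g F x ∂surfaceMeasure

/-- The element-local problem on the cell `T` with boundary data `lam`. -/
structure IsLocalSolution (m : Method) (dt : ℝ) (T : Finset E3) (lam : E3 → E3)
    (s : LocalTriple) : Prop where
  L_mem : s.L ∈ m.W
  u_mem : s.u ∈ m.V
  p_mem : s.p ∈ m.Q
  /-- `(L, G)_T + (u, ∇·G)_T = ⟪lam, G ν⟫_∂T` -/
  gradient_eq : ∀ G ∈ m.W,
    innerM T s.L G + innerV T s.u (divergence G) =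
      boundaryIntegral T fun F x =>
        ∑ i, lam x i * ∑ j, pval (G i j) x * outerNormal T F j
  /-- `(-∇·L + ∇p, v)_T + ⟪S (u - lam), v⟫_∂T = 0` -/
  momentum_eq : ∀ v ∈ m.V,
    innerV T (-divergence s.L + grad s.p) v +
      boundaryIntegral T (fun F x =>
        ∑ i, m.stab T F * (pval (s.u i) x - lam x i) * pval (v i) x) = 0
  /-- `(1/Δt) (p, q)_T - (u, ∇q)_T = -⟪lam·ν, q⟫_∂T` -/
  balance_eq : ∀ q ∈ m.Q,
    1 / dt * innerS T s.p q - innerV T s.u (grad q) =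
      -boundaryIntegral T fun F x => (∑ i, lam x i * outerNormal T F i) * pval q x

/-- The local solver: the solution of the element-local problem (an arbitrary triple if there is
no solution). -/
def localSolver (m : Method) (dt : ℝ) (T : Finset E3) (lam : E3 → E3) : LocalTriple :=
  Classical.epsilon (IsLocalSolution m dt T lam)

/-! ### The condensed bilinear form -/

/-- `(L lam, L mu)`, with `(·, ·)` assembled from the cells. -/
def gradientTerm {Ω : Set E3} (mesh : TetMesh Ω) (m : Method) (dt : ℝ) (lam mu : E3 → E3) : ℝ :=
  ∑ T ∈ mesh.cells, innerM T (localSolver m dt T lam).L (localSolver m dt T mu).L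

/-- `⟪S (u lam - lam), u mu - mu⟫`, where interior faces are counted from both sides. -/
def stabilizationTerm {Ω : Set E3} (mesh : TetMesh Ω) (m : Method) (dt : ℝ)
    (lam mu : E3 → E3) : ℝ :=
  ∑ T ∈ mesh.cells, boundaryIntegral T fun F x =>
    ∑ i, m.stab T F * (pval ((localSolver m dt T lam).u i) x - lam x i) *
      (pval ((localSolver m dt T mu).u i) x - mu x i)

/-- `(p lam, p mu)`, with `(·, ·)` assembled from the cells. -/
def pressureTerm {Ω : Set E3} (mesh : TetMesh Ω) (m : Method) (dt : ℝ) (lam mu : E3 → E3) : ℝ :=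
  ∑ T ∈ mesh.cells, innerS T (localSolver m dt T lam).p (localSolver m dt T mu).p

/-- The condensed augmented Lagrangian bilinear form
`a(lam, mu) = (L lam, L mu) + ⟪S (u lam - lam), u mu - mu⟫ + (1/Δt) (p lam, p mu)`. -/
def aForm {Ω : Set E3} (mesh : TetMesh Ω) (m : Method) (dt : ℝ) (lam mu : E3 → E3) : ℝ :=
  gradientTerm mesh m dt lam mu + stabilizationTerm mesh m dt lam mu +
    1 / dt * pressureTerm mesh m dt lam mu

end StokesHDG

end

open MeasureTheory

noncomputable section

namespace StokesHDG

/-! ### Polynomial spaces -/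

/-! Everything is local to one cell and starts from the Raviart–Thomas solution. There `τ = 0`, and
`-∇·L + ∇p` is itself an admissible test field, so `∇·L = ∇p` holds exactly and `∇·L` has degree at
most `p - 1`. Now `∇·(x c)` multiplies the degree `k` part of `c` by `k + 3`, so a Raviart–Thomas
row with such a divergence has no top-degree radial part. Hence `L` already lies in `[P_p]^{3×3}`
(`divergence_eq_grad`, `mem_rowwise_of_divergence_mem`).

For test functions `G ∈ [P_p]^{3×3}` and `q ∈ P_p`, the velocity enters the first and third
equations only through its moments against `∇·G` and `∇q`, that is, against `[P_{p-1}]^3`. Keeping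
`L` and the pressure, one may thus replace `u` by any admissible field with the same moments that
equals `λ` wherever `τ ≠ 0` (`IsLocalSolution.transfer`). For BDM-H this field is the `L²`
projection onto `[P_{p-1}]^3`. For SFH it is `r + ℓ w`, where `r` is the polynomial that represents
`λ` on `F*`, `ℓ` is the barycentric coordinate vanishing on `F*`, and `w ∈ [P_{p-1}]^3` is found by
Riesz representation with weight `ℓ`. Its trace on `F*` is `λ`, so the stabilization vanishes.

Uniqueness comes from the energy identity: for zero data `L` and `p` vanish, `u` is orthogonal to
`∇·W`, and `u = 0` on stabilized faces. For RT-H and BDM-H the divergence maps `W` onto `V`, so `u =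
0`. For SFH, `u = ℓ w` with `w` of degree at most `p - 1`; choosing `∇·G = w` gives `∫ ℓ |w|² = 0`.
Existence is needed only for RT-H, where it follows from uniqueness by finite dimensionality; the
other two solutions are built from that one. -/

open MvPolynomial in
theorem mem_polySpace {k : ℤ} {q : Poly3} :
    q ∈ polySpace k ↔ ∀ m, coeff m q ≠ 0 → (m.degree : ℤ) ≤ k := by
  simp only [polySpace, mem_restrictSupport_iff, Set.subset_def, Finset.mem_coe, mem_support_iff]
  rfl

theorem polySpace_mono {j k : ℤ} (h : j ≤ k) : polySpace j ≤ polySpace k :=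
  fun _ hq => mem_polySpace.2 fun m hm => (mem_polySpace.1 hq m hm).trans h

theorem polySpace_fg (k : ℤ) : (polySpace k).FG := by
  have hfin : {n : Fin 3 →₀ ℕ | (n.degree : ℤ) ≤ k}.Finite :=
    (Finsupp.finite_of_degree_le (σ := Fin 3) k.toNat).subset fun n hn => by
      have : (n.degree : ℤ) ≤ k := hn
      change n.degree ≤ k.toNat
      omega
  rw [polySpace, MvPolynomial.restrictSupport_eq_span]
  exact Submodule.fg_span (hfin.image _)

theorem vecPolySpace_fg (k : ℤ) : (vecPolySpace k).FG :=
  Submodule.fg_pi fun _ => polySpace_fg k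

theorem mem_vecPolySpace {k : ℤ} {v : Fin 3 → Poly3} :
    v ∈ vecPolySpace k ↔ ∀ i, v i ∈ polySpace k := by
  simp [vecPolySpace]

theorem mul_mem_polySpace {j k : ℤ} {a b : Poly3} (ha : a ∈ polySpace j) (hb : b ∈ polySpace k) :
    a * b ∈ polySpace (j + k) := by
  classical
  rw [mem_polySpace] at *
  intro m hm
  obtain ⟨x, hx, y, hy, rfl⟩ := Finset.mem_add.1
    (MvPolynomial.support_mul a b (MvPolynomial.mem_support_iff.2 hm))
  have h1 := ha x (MvPolynomial.mem_support_iff.1 hx)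
  have h2 := hb y (MvPolynomial.mem_support_iff.1 hy)
  rw [map_add]
  push_cast
  omega

theorem monomial_mem_polySpace {k : ℤ} {m : Fin 3 →₀ ℕ} (h : (m.degree : ℤ) ≤ k) (c : ℝ) :
    MvPolynomial.monomial m c ∈ polySpace k :=
  (MvPolynomial.monomial_mem_restrictSupport ℝ).2 (Or.inl h)

theorem C_mem_polySpace (c : ℝ) : (MvPolynomial.C c : Poly3) ∈ polySpace 0 :=
  monomial_mem_polySpace (by simp) c

theorem X_mem_polySpace (i : Fin 3) : (MvPolynomial.X i : Poly3) ∈ polySpace 1 :=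
  monomial_mem_polySpace (by simp) 1

theorem pderiv_mem_polySpace {k : ℤ} {q : Poly3} (hq : q ∈ polySpace k) (i : Fin 3) :
    MvPolynomial.pderiv i q ∈ polySpace (k - 1) := by
  rw [mem_polySpace] at *
  intro m hm
  rw [MvPolynomial.coeff_pderiv] at hm
  have := hq _ (left_ne_zero_of_mul hm)
  rw [map_add, Finsupp.degree_single] at this
  push_cast at this
  omega

/-! ### Divergences of radial fields and Raviart–Thomas spaces -/

/-- The divergence of `x c`. -/
def radialDiv (c : Poly3) : Poly3 := ∑ j, MvPolynomial.pderiv j (MvPolynomial.X j * c)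

/-- Euler's identity, one monomial at a time: `∂_j (x_j c)` multiplies the coefficient of `m` by
`m_j + 1`, and the three factors add up to `|m| + 3`. So `c ↦ ∇·(x c)` is diagonal in the monomials
with no zero eigenvalue; it can be inverted and neither raises nor lowers the degree. -/
theorem coeff_radialDiv (m : Fin 3 →₀ ℕ) (c : Poly3) :
    MvPolynomial.coeff m (radialDiv c) = ((m.degree : ℝ) + 3) * MvPolynomial.coeff m c := by
  have h (j : Fin 3) : MvPolynomial.coeff m (MvPolynomial.pderiv j (MvPolynomial.X j * c)) =
      MvPolynomial.coeff m c * ((m j : ℝ) + 1) := by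
    rw [MvPolynomial.coeff_pderiv, mul_comm (MvPolynomial.X j), MvPolynomial.coeff_mul_X]
  rw [radialDiv, MvPolynomial.coeff_sum, Finset.sum_congr rfl fun j _ => h j,
    Finsupp.degree_eq_sum, Fin.sum_univ_three, Fin.sum_univ_three]
  push_cast
  ring

theorem radialDiv_mem_iff {k : ℤ} {c : Poly3} : radialDiv c ∈ polySpace k ↔ c ∈ polySpace k := by
  simp only [mem_polySpace, coeff_radialDiv]
  refine forall_congr' fun m => ?_
  have : (m.degree : ℝ) + 3 ≠ 0 := by positivity
  simp [this]

theorem exists_radialDiv_eq {k : ℤ} {b : Poly3} (hb : b ∈ polySpace k) :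
    ∃ c ∈ polySpace k, radialDiv c = b := by
  classical
  have h : radialDiv (∑ m ∈ b.support,
      MvPolynomial.monomial m (MvPolynomial.coeff m b / ((m.degree : ℝ) + 3))) = b := by
    ext m
    have h0 : (m.degree : ℝ) + 3 ≠ 0 := by positivity
    rw [coeff_radialDiv, MvPolynomial.coeff_sum]
    simp only [MvPolynomial.coeff_monomial, Finset.sum_ite_eq', MvPolynomial.mem_support_iff]
    split_ifs with hm
    · field_simp
    · rw [not_not.1 hm, mul_zero]
  exact ⟨_, radialDiv_mem_iff.1 (h.symm ▸ hb :), h⟩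

/-- The field `x c`. -/
def radialField (c : Poly3) : Fin 3 → Poly3 := fun j => MvPolynomial.X j * c

theorem radialField_mem_vecPolySpace {k : ℤ} {c : Poly3} (hc : c ∈ polySpace (k - 1)) :
    radialField c ∈ vecPolySpace k :=
  mem_vecPolySpace.2 fun j => by
    simpa [radialField] using mul_mem_polySpace (X_mem_polySpace j) hc

theorem radialField_mem_raviartThomas {p : ℕ} {c : Poly3} (hc : c ∈ polySpace p) :
    radialField c ∈ raviartThomas p :=
  Submodule.mem_sup_right ⟨c, hc, rfl⟩

theorem vecPolySpace_le_raviartThomas (p : ℕ) : vecPolySpace p ≤ raviartThomas p := le_sup_left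

theorem mem_raviartThomas {p : ℕ} {r : Fin 3 → Poly3} :
    r ∈ raviartThomas p ↔ ∃ a ∈ vecPolySpace p, ∃ c ∈ polySpace p, a + radialField c = r := by
  rw [raviartThomas, Submodule.mem_sup]
  refine exists_congr fun a => and_congr_right fun _ => ⟨?_, ?_⟩
  · rintro ⟨_, ⟨c, hc, rfl⟩, h⟩
    exact ⟨c, hc, h⟩
  · rintro ⟨c, hc, h⟩
    exact ⟨_, ⟨c, hc, rfl⟩, h⟩

theorem raviartThomas_fg (p : ℕ) : (raviartThomas p).FG :=
  (vecPolySpace_fg p).sup ((polySpace_fg p).map _)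

theorem sum_pderiv_mem {k : ℤ} {a : Fin 3 → Poly3} (ha : a ∈ vecPolySpace k) :
    ∑ j, MvPolynomial.pderiv j (a j) ∈ polySpace (k - 1) :=
  Submodule.sum_mem _ fun j _ => pderiv_mem_polySpace (mem_vecPolySpace.1 ha j) j

theorem divergence_mem_of_vecPolySpace {k : ℤ} {G : Matrix (Fin 3) (Fin 3) Poly3}
    (hG : G ∈ rowwise (vecPolySpace k)) : divergence G ∈ vecPolySpace (k - 1) :=
  mem_vecPolySpace.2 fun i => sum_pderiv_mem (hG i)

theorem grad_mem {k : ℤ} {q : Poly3} (hq : q ∈ polySpace k) : grad q ∈ vecPolySpace (k - 1) :=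
  mem_vecPolySpace.2 fun i => pderiv_mem_polySpace hq i

theorem sum_pderiv_add_radialField (a : Fin 3 → Poly3) (c : Poly3) :
    ∑ j, MvPolynomial.pderiv j ((a + radialField c) j) =
      ∑ j, MvPolynomial.pderiv j (a j) + radialDiv c := by
  simp only [Pi.add_apply, map_add, Finset.sum_add_distrib]
  rfl

theorem divergence_mem_of_raviartThomas {p : ℕ} {G : Matrix (Fin 3) (Fin 3) Poly3}
    (hG : G ∈ rowwise (raviartThomas p)) : divergence G ∈ vecPolySpace p := by
  refine mem_vecPolySpace.2 fun i => ?_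
  obtain ⟨a, ha, c, hc, h⟩ := mem_raviartThomas.1 (hG i)
  rw [divergence, ← h, sum_pderiv_add_radialField]
  exact Submodule.add_mem _ (polySpace_mono (by omega) (sum_pderiv_mem ha))
    (radialDiv_mem_iff.2 hc)

/-- A Raviart--Thomas field with divergence of degree at most `p - 1` has degree at most `p`. -/
theorem mem_rowwise_of_divergence_mem {p : ℕ} {G : Matrix (Fin 3) (Fin 3) Poly3}
    (hG : G ∈ rowwise (raviartThomas p)) (hd : divergence G ∈ vecPolySpace ((p : ℤ) - 1)) :
    G ∈ rowwise (vecPolySpace p) := by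
  intro i
  obtain ⟨a, ha, c, hc, h⟩ := mem_raviartThomas.1 (hG i)
  have h1 := mem_vecPolySpace.1 hd i
  -- The divergence of `a` has degree at most `p - 1` anyway, so the hypothesis bounds that of `x c`
  -- alone, and with it `c`.
  rw [divergence, ← h, sum_pderiv_add_radialField,
    Submodule.add_mem_iff_right _ (sum_pderiv_mem ha), radialDiv_mem_iff] at h1
  rw [← h]
  exact Submodule.add_mem _ ha (radialField_mem_vecPolySpace h1)

/-- Radial rows suffice: `∇·(x c)` already takes every value in `P_k` as `c` runs through `P_k`. -/
theorem exists_divergence_eq {S : Submodule ℝ (Fin 3 → Poly3)} {k : ℤ}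
    (hS : ∀ c ∈ polySpace k, radialField c ∈ S) {v : Fin 3 → Poly3} (hv : v ∈ vecPolySpace k) :
    ∃ G ∈ rowwise S, divergence G = v := by
  choose c hc h using fun i => exists_radialDiv_eq (mem_vecPolySpace.1 hv i)
  exact ⟨fun i => radialField (c i), fun i => hS _ (hc i), funext h⟩

theorem exists_divergence_eq_of_vecPolySpace {k : ℤ} {v : Fin 3 → Poly3}
    (hv : v ∈ vecPolySpace (k - 1)) : ∃ G ∈ rowwise (vecPolySpace k), divergence G = v :=
  exists_divergence_eq (fun _ => radialField_mem_vecPolySpace) hv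

theorem exists_divergence_eq_of_raviartThomas {p : ℕ} {v : Fin 3 → Poly3}
    (hv : v ∈ vecPolySpace p) : ∃ G ∈ rowwise (raviartThomas p), divergence G = v :=
  exists_divergence_eq (fun _ => radialField_mem_raviartThomas) hv

/-! ### Division by an affine function, with control of the degree -/

/-- The substitution `x ↦ x - l(x) d`. -/
def shear (l : Poly3) (d : Fin 3 → ℝ) : Poly3 →ₐ[ℝ] Poly3 :=
  MvPolynomial.bind₁ fun i => MvPolynomial.X i - l * MvPolynomial.C (d i)

/-- The substitution `s` is the identity modulo `l`. The quotient is tracked by induction on the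
degree through `x_i v - s(x_i v) = x_i (v - s v) + l d_i s(v)`. -/
theorem exists_sub_shear_eq_monomial {l : Poly3} (hl : l ∈ polySpace 1) (d : Fin 3 → ℝ)
    (n : ℕ) : ∀ m : Fin 3 →₀ ℕ, m.degree = n →
    ∃ w ∈ polySpace ((n : ℤ) - 1),
      MvPolynomial.monomial m 1 - shear l d (MvPolynomial.monomial m 1) = l * w := by
  induction n with
  | zero =>
    intro m hm
    obtain rfl := (Finsupp.degree_eq_zero_iff m).1 hm
    refine ⟨0, Submodule.zero_mem _, ?_⟩
    rw [← MvPolynomial.C_apply, map_one, map_one, sub_self, mul_zero]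
  | succ n ih =>
    intro m hm
    obtain ⟨i, hi⟩ : ∃ i, m i ≠ 0 := by
      by_contra! h
      have : m = 0 := Finsupp.ext h
      simp [this] at hm
    set m' := m - Finsupp.single i 1 with hm'
    have hadd : Finsupp.single i 1 + m' = m :=
      add_tsub_cancel_of_le (Finsupp.single_le_iff.2 (Nat.one_le_iff_ne_zero.2 hi))
    have hdeg : m'.degree = n := by
      rw [← hadd, map_add, Finsupp.degree_single] at hm
      omega
    obtain ⟨w, hw, h⟩ := ih m' hdeg
    have hv : (MvPolynomial.monomial m' 1 : Poly3) ∈ polySpace n :=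
      monomial_mem_polySpace (by omega) 1
    -- The degree of the substituted monomial is read off from the induction hypothesis, as `v - l
    -- w`.
    have hs : shear l d (MvPolynomial.monomial m' 1) ∈ polySpace n := by
      rw [← sub_sub_cancel (MvPolynomial.monomial m' 1) (shear l d (MvPolynomial.monomial m' 1)), h]
      refine Submodule.sub_mem _ hv ?_
      simpa using mul_mem_polySpace hl hw
    have hX : (MvPolynomial.monomial m 1 : Poly3) =
        MvPolynomial.X i * MvPolynomial.monomial m' 1 := by
      rw [MvPolynomial.X, MvPolynomial.monomial_mul, hadd, one_mul]
    refine ⟨MvPolynomial.X i * w +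
      MvPolynomial.C (d i) * shear l d (MvPolynomial.monomial m' 1), ?_, ?_⟩
    · push_cast
      rw [add_sub_cancel_right]
      refine Submodule.add_mem _ ?_ ?_
      · simpa using mul_mem_polySpace (X_mem_polySpace i) hw
      · simpa using mul_mem_polySpace (C_mem_polySpace (d i)) hs
    · have hsX : shear l d (MvPolynomial.X i) = MvPolynomial.X i - l * MvPolynomial.C (d i) := by
        simp [shear]
      rw [hX, map_mul, hsX]
      linear_combination MvPolynomial.X i * h

theorem exists_sub_shear_eq {l : Poly3} (hl : l ∈ polySpace 1) (d : Fin 3 → ℝ) {k : ℤ}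
    {u : Poly3} (hu : u ∈ polySpace k) :
    ∃ w ∈ polySpace (k - 1), u - shear l d u = l * w := by
  rw [polySpace, MvPolynomial.restrictSupport_eq_span] at hu
  induction hu using Submodule.span_induction with
  | mem x hx =>
    obtain ⟨m, hm, rfl⟩ := hx
    obtain ⟨w, hw, h⟩ := exists_sub_shear_eq_monomial hl d _ m rfl
    have hm : (m.degree : ℤ) ≤ k := hm
    exact ⟨w, polySpace_mono (by omega) hw, h⟩
  | zero => exact ⟨0, Submodule.zero_mem _, by simp⟩
  | add x y _ _ hx hy =>
    obtain ⟨w, hw, h⟩ := hx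
    obtain ⟨w', hw', h'⟩ := hy
    refine ⟨w + w', Submodule.add_mem _ hw hw', ?_⟩
    rw [map_add, mul_add, ← h, ← h']
    ring
  | smul c x _ hx =>
    obtain ⟨w, hw, h⟩ := hx
    exact ⟨c • w, Submodule.smul_mem _ c hw, by rw [map_smul, ← smul_sub, h, mul_smul_comm]⟩

/-! ### Values of polynomials and the identity principle -/

section PolynomialIntegrals

theorem pval_add (a b : Poly3) (x : E3) : pval (a + b) x = pval a x + pval b x := by simp [pval]

theorem pval_mul (a b : Poly3) (x : E3) : pval (a * b) x = pval a x * pval b x := by simp [pval]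

theorem pval_smul (c : ℝ) (a : Poly3) (x : E3) : pval (c • a) x = c * pval a x := by simp [pval]

theorem pval_sub (a b : Poly3) (x : E3) : pval (a - b) x = pval a x - pval b x := by simp [pval]

theorem pval_C (c : ℝ) (x : E3) : pval (MvPolynomial.C c) x = c := by simp [pval]

theorem pval_sum {ι : Type*} (s : Finset ι) (f : ι → Poly3) (x : E3) :
    pval (∑ i ∈ s, f i) x = ∑ i ∈ s, pval (f i) x := by simp [pval]

theorem continuous_pval (q : Poly3) : Continuous (pval q) :=
  (MvPolynomial.continuous_eval q).comp (by fun_prop)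

theorem eq_zero_of_pval_eq_zero {q : Poly3} (h : ∀ x, pval q x = 0) : q = 0 :=
  MvPolynomial.funext fun x => by
    rw [map_zero]
    exact h (WithLp.toLp 2 x)

/-- Identity principle for analytic functions. The affine map covers both uses: all of space, for
cells, and the parametrized plane of a face. -/
theorem pval_comp_eq_zero {V : Type*} [NormedAddCommGroup V] [NormedSpace ℝ V] (a : E3)
    (A : V →L[ℝ] E3) (q : Poly3) {U : Set V} (hU : IsOpen U) (hne : U.Nonempty)
    (h : ∀ y ∈ U, pval q (a + A y) = 0) (y : V) : pval q (a + A y) = 0 := by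
  have han : AnalyticOnNhd ℝ (fun y => pval q (a + A y)) Set.univ := by
    have := AnalyticOnNhd.aeval_mvPolynomial (𝕜 := ℝ) (s := Set.univ) (B := ℝ)
      (f := fun (y : V) (i : Fin 3) => (a + A y) i) (fun i => ?_) q
    · simpa [pval, MvPolynomial.coe_aeval_eq_eval] using this
    · have h1 : AnalyticOnNhd ℝ
          (fun y => a i + ((EuclideanSpace.proj i : E3 →L[ℝ] ℝ).comp A) y) Set.univ :=
        analyticOnNhd_const.add (ContinuousLinearMap.analyticOnNhd _ _)
      exact h1
  obtain ⟨z, hz⟩ := hne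
  exact han.eqOn_zero_of_preconnected_of_eventuallyEq_zero isPreconnected_univ (Set.mem_univ z)
    (Filter.eventually_of_mem (hU.mem_nhds hz) h) (Set.mem_univ y)

/-! ### Tetrahedra with a marked face -/

theorem affineIndependent_of_image_eq {n : ℕ} {T : Finset E3} {f : Fin n → E3}
    (hT : AffineIndependent ℝ ((↑) : T → E3)) (hcard : T.card = n)
    (hf : (T : Set E3) = Set.range f) : AffineIndependent ℝ f := by
  have hmem (i : Fin n) : f i ∈ T := by
    rw [← Finset.mem_coe, hf]
    exact Set.mem_range_self i
  let g : Fin n → T := fun i => ⟨f i, hmem i⟩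
  have hsurj : Function.Surjective g := by
    rintro ⟨x, hx⟩
    rw [← Finset.mem_coe, hf] at hx
    obtain ⟨i, rfl⟩ := hx
    exact ⟨i, rfl⟩
  have hinj : Function.Injective g :=
    ((Fintype.bijective_iff_surjective_and_card g).2 ⟨hsurj, by simp [hcard]⟩).1
  exact hT.comp_embedding ⟨g, hinj⟩

/-- The vertices are numbered so that index `3` is the one opposite the marked face; `B.coord 3` is
then the coordinate that vanishes on that face. -/
theorem exists_affineBasis {T F : Finset E3} (hT : AffineIndependent ℝ ((↑) : T → E3))
    (hcard : T.card = 4) (hF : F ∈ facesOf T) :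
    ∃ B : AffineBasis (Fin 4) ℝ E3,
      (T : Set E3) = Set.range B ∧ (F : Set E3) = {B 0, B 1, B 2} := by
  classical
  obtain ⟨hsub, hF3⟩ := Finset.mem_powersetCard.1 hF
  obtain ⟨v, hvT, hv⟩ := Finset.exists_mem_notMem_of_card_lt_card (s := F) (t := T) (by omega)
  have hT' : insert v F = T := Finset.eq_of_subset_of_card_le (Finset.insert_subset hvT hsub)
    (by rw [Finset.card_insert_of_notMem hv]; omega)
  obtain ⟨a, b, c, -, -, -, hFe⟩ := Finset.card_eq_three.1 hF3
  have hTr : (T : Set E3) = Set.range ![a, b, c, v] := by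
    rw [← hT', hFe]
    simp only [Matrix.range_cons, Matrix.range_empty, Finset.coe_insert, Finset.coe_singleton]
    ext x
    simp only [Set.mem_insert_iff, Set.mem_union, Set.mem_singleton_iff, Set.mem_empty_iff_false]
    tauto
  have hind := affineIndependent_of_image_eq hT hcard hTr
  refine ⟨⟨![a, b, c, v], hind, ?_⟩, hTr, ?_⟩
  · rw [hind.affineSpan_eq_top_iff_card_eq_finrank_add_one, finrank_euclideanSpace,
      Fintype.card_fin, Fintype.card_fin]
  · rw [hFe, Finset.coe_insert, Finset.coe_insert, Finset.coe_singleton]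
    rfl

variable (B : AffineBasis (Fin 4) ℝ E3)

/-- The barycentric coordinate of the vertex opposite the marked face, as a polynomial. -/
def coordPoly : Poly3 :=
  MvPolynomial.C (B.coord 3 0) +
    ∑ i, MvPolynomial.C ((B.coord 3).linear (EuclideanSpace.single i 1)) * MvPolynomial.X i

theorem pval_coordPoly (x : E3) : pval (coordPoly B) x = B.coord 3 x := by
  have h1 : B.coord 3 x = (B.coord 3).linear x + B.coord 3 0 := by
    have := (B.coord 3).map_vadd 0 x
    rwa [vadd_eq_add, vadd_eq_add, add_zero] at this
  have h2 : x = ∑ i, x i • EuclideanSpace.single i (1 : ℝ) := by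
    ext j
    simp [Fin.sum_univ_three]
    fin_cases j <;> simp
  rw [h1]
  nth_rewrite 2 [h2]
  simp [pval, coordPoly, add_comm, mul_comm]

theorem coordPoly_mem : coordPoly B ∈ polySpace 1 := by
  refine Submodule.add_mem _ (polySpace_mono zero_le_one (C_mem_polySpace _))
    (Submodule.sum_mem _ fun i _ => ?_)
  have := mul_mem_polySpace (C_mem_polySpace ((B.coord 3).linear (EuclideanSpace.single i 1)))
    (X_mem_polySpace i)
  rwa [zero_add] at this

/-- The linear part of the parametrization of the plane of the marked face. -/
def planeMap : (Fin 2 → ℝ) →L[ℝ] E3 :=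
  LinearMap.toContinuousLinearMap
    (Fintype.linearCombination ℝ ![B 1 - B 0, B 2 - B 0])

theorem planeMap_apply (y : Fin 2 → ℝ) :
    planeMap B y = y 0 • (B 1 - B 0) + y 1 • (B 2 - B 0) := by
  simp [planeMap, Fintype.linearCombination_apply]

theorem planeMap_injective : Function.Injective (planeMap B) := by
  have h1 := (affineIndependent_iff_linearIndependent_vsub ℝ B 0).1 B.ind
  have h2 : LinearIndependent ℝ ![B 1 - B 0, B 2 - B 0] := by
    have h3 := h1.comp (![⟨1, by decide⟩, ⟨2, by decide⟩] : Fin 2 → {i : Fin 4 // i ≠ 0})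
      fun i j h => by
        fin_cases i <;> fin_cases j <;>
          first | rfl | exact absurd (congrArg Subtype.val h) (by decide)
    have h4 : ((fun i : {i : Fin 4 // i ≠ 0} => B i -ᵥ B 0) ∘ ![⟨1, by decide⟩, ⟨2, by decide⟩]) =
        ![B 1 - B 0, B 2 - B 0] := by
      funext j
      fin_cases j <;> rfl
    rwa [h4] at h3
  exact linearIndependent_iff_injective_fintypeLinearCombination.1 h2

/-- A polynomial that vanishes on the plane of the marked face is divisible by the barycentric
coordinate. -/
theorem exists_eq_coordPoly_mul {k : ℤ} {u : Poly3} (hu : u ∈ polySpace k)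
    (h : ∀ y, pval u (B 0 + planeMap B y) = 0) :
    ∃ w ∈ polySpace (k - 1), u = coordPoly B * w := by
  -- The coordinate grows by `1` along `B 3 - B 0`, so the substitution is the projection onto the
  -- plane of the face in this direction, and it kills `u`.
  obtain ⟨w, hw, hs⟩ := exists_sub_shear_eq (coordPoly_mem B) (⇑(B 3 - B 0)) hu
  refine ⟨w, hw, ?_⟩
  suffices shear (coordPoly B) (⇑(B 3 - B 0)) u = 0 by rwa [this, sub_zero] at hs
  refine eq_zero_of_pval_eq_zero fun x => ?_
  have h1 : pval (shear (coordPoly B) (⇑(B 3 - B 0)) u) x =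
      pval u (x - B.coord 3 x • (B 3 - B 0)) := by
    simp only [shear, pval, MvPolynomial.eval, MvPolynomial.eval₂Hom_bind₁]
    congr 2
    ext i
    have := pval_coordPoly B x
    simp only [pval, MvPolynomial.eval] at this
    change MvPolynomial.eval₂Hom _ _ (MvPolynomial.X i - coordPoly B * MvPolynomial.C _) = _
    rw [map_sub, map_mul, this]
    simp
  have h2 : x - B.coord 3 x • (B 3 - B 0) = B 0 + planeMap B ![B.coord 1 x, B.coord 2 x] := by
    have hx := B.linear_combination_coord_eq_self x
    have hone := B.sum_coord_apply_eq_one x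
    rw [Fin.sum_univ_four] at hx hone
    have h0 : B.coord 0 x = 1 - B.coord 1 x - B.coord 2 x - B.coord 3 x := by linarith
    rw [h0] at hx
    rw [planeMap_apply]
    nth_rewrite 1 [← hx]
    simp only [Matrix.cons_val_zero, Matrix.cons_val_one]
    module
  rw [h1, h2, h]

/-! ### Integrals of polynomials over cells -/

variable {B} {T F : Finset E3}

theorem hull_eq_of_range (hT : (T : Set E3) = Set.range B) :
    hull T = {x | ∀ i, 0 ≤ B.coord i x} := by
  rw [hull, hT, B.convexHull_eq_nonneg_coord]

theorem isCompact_hull (T : Finset E3) : IsCompact (hull T) :=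
  Set.Finite.isCompact_convexHull ℝ T.finite_toSet

theorem integrableOn_cell (T : Finset E3) (q : Poly3) : IntegrableOn (pval q) (hull T) :=
  (continuous_pval q).continuousOn.integrableOn_compact (isCompact_hull T)

theorem eq_zero_of_ae_cell (hT : (T : Set E3) = Set.range B) {q : Poly3}
    (h : ∀ᵐ x ∂(volume.restrict (hull T)), pval q x = 0) : q = 0 := by
  have hint : interior (hull T) = {x | ∀ i, 0 < B.coord i x} := by
    rw [hull, hT, B.interior_convexHull]
  have hne : (interior (hull T)).Nonempty := by
    rw [hull, hT]
    exact ⟨_, B.centroid_mem_interior_convexHull⟩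
  -- On an open set, continuity turns vanishing almost everywhere into vanishing everywhere.
  have h1 : Set.EqOn (pval q) 0 (interior (hull T)) :=
    Measure.eqOn_open_of_ae_eq (ae_restrict_of_ae_restrict_of_subset interior_subset h)
      isOpen_interior (continuous_pval q).continuousOn continuousOn_const
  refine eq_zero_of_pval_eq_zero fun x => ?_
  have := pval_comp_eq_zero 0 (ContinuousLinearMap.id ℝ E3) q isOpen_interior hne
    (fun y hy => by simpa using h1 hy) x
  simpa using this

/-- The integral over a cell of a polynomial. -/
def cellInt (T : Finset E3) : Poly3 →ₗ[ℝ] ℝ where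
  toFun q := ∫ x in hull T, pval q x
  map_add' a b := by
    simp only [pval_add]
    exact integral_add (integrableOn_cell T a) (integrableOn_cell T b)
  map_smul' c a := by
    simp only [pval_smul]
    exact integral_const_mul _ _

theorem cellInt_sq_nonneg (T : Finset E3) (q : Poly3) : 0 ≤ cellInt T (q * q) :=
  integral_nonneg fun x => by
    rw [pval_mul]
    exact mul_self_nonneg _

/-- A nonnegative integrand with zero integral vanishes almost everywhere, so `ω q² = 0` as a
polynomial, and the polynomial ring is a domain. The weight may therefore vanish on part of the
boundary, as the barycentric coordinate does. -/
theorem eq_zero_of_cellInt_weight (hT : (T : Set E3) = Set.range B) {ω q : Poly3} (hω : ω ≠ 0)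
    (hpos : ∀ x ∈ hull T, 0 ≤ pval ω x) (h : cellInt T (ω * q * q) = 0) : q = 0 := by
  have h0 : 0 ≤ᵐ[volume.restrict (hull T)] pval (ω * q * q) :=
    (ae_restrict_mem (isCompact_hull T).measurableSet).mono fun x hx => by
      rw [pval_mul, pval_mul, mul_assoc]
      exact mul_nonneg (hpos x hx) (mul_self_nonneg _)
  have h1 := (integral_eq_zero_iff_of_nonneg_ae h0 (integrableOn_cell T _)).1 h
  have h2 : ω * q * q = 0 := eq_zero_of_ae_cell hT h1
  simpa [hω] using h2

theorem eq_zero_of_cellInt_sq (hT : (T : Set E3) = Set.range B) {q : Poly3}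
    (h : cellInt T (q * q) = 0) : q = 0 :=
  eq_zero_of_cellInt_weight hT (one_ne_zero (α := Poly3)) (fun x _ => by simp [pval])
    (by rwa [one_mul])

theorem eq_zero_of_cellInt_coordPoly (hT : (T : Set E3) = Set.range B) {q : Poly3}
    (h : cellInt T (coordPoly B * q * q) = 0) : q = 0 := by
  refine eq_zero_of_cellInt_weight hT (fun h0 => ?_) (fun x hx => ?_) h
  · have := pval_coordPoly B (B 3)
    simp [h0, pval] at this
  · rw [pval_coordPoly]
    rw [hull_eq_of_range hT] at hx
    exact hx 3

/-! ### Integrals of polynomials over faces -/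

/-- The unit square is larger than the parameter triangle, but it is enough to bound the area and to
place the face in its plane. -/
theorem hull_subset_image (hF : (F : Set E3) = {B 0, B 1, B 2}) :
    hull F ⊆ (fun y => B 0 + planeMap B y) '' Set.Icc 0 1 := by
  refine convexHull_min ?_ ?_
  · rw [hF]
    rintro _ (rfl | rfl | rfl)
    · exact ⟨0, by simp, by simp⟩
    · refine ⟨![1, 0], ?_, by simp [planeMap_apply]⟩
      constructor <;> intro i <;> fin_cases i <;> simp
    · refine ⟨![0, 1], ?_, by simp [planeMap_apply]⟩
      constructor <;> intro i <;> fin_cases i <;> simp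
  · have := ((convex_Icc (0 : Fin 2 → ℝ) 1).linear_image (planeMap B).toLinearMap).translate (B 0)
    rwa [Set.image_image] at this

theorem lipschitz_plane : ∃ K, LipschitzWith K fun y => B 0 + planeMap B y :=
  ⟨_, LipschitzWith.of_dist_le_mul fun x y => by
    rw [dist_add_left]
    exact (planeMap B).lipschitz.dist_le_mul x y⟩

theorem antilipschitz_plane : ∃ K, AntilipschitzWith K fun y => B 0 + planeMap B y := by
  obtain ⟨K, -, hK⟩ := (planeMap B).toLinearMap.exists_antilipschitzWith
    (LinearMap.ker_eq_bot.2 (planeMap_injective B))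
  exact ⟨K, AntilipschitzWith.of_le_mul_dist fun x y => by
    rw [dist_add_left]
    exact hK.le_mul_dist x y⟩

theorem hausdorffMeasure_two_eq_volume : (μH[2] : Measure (Fin 2 → ℝ)) = volume := by
  have := hausdorffMeasure_pi_real (ι := Fin 2)
  simpa using this

/-- A Lipschitz image of the unit square has finite `μH[2]`, and the surface measure is a constant
multiple of `μH[2]`. -/
theorem surfaceMeasure_hull_lt_top (hF : (F : Set E3) = {B 0, B 1, B 2}) :
    surfaceMeasure (hull F) < ⊤ := by
  obtain ⟨K, hK⟩ := lipschitz_plane (B := B)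
  have h1 : μH[2] (hull F) < ⊤ := by
    refine (measure_mono (hull_subset_image hF)).trans_lt
      ((hK.hausdorffMeasure_image_le zero_le_two _).trans_lt ?_)
    rw [hausdorffMeasure_two_eq_volume]
    refine ENNReal.mul_lt_top (by simp) isCompact_Icc.measure_lt_top
  rw [surfaceMeasure, Measure.euclideanHausdorffMeasure_def, Measure.smul_apply]
  simpa [ENNReal.smul_def] using ENNReal.mul_lt_top ENNReal.coe_lt_top h1

theorem integrableOn_face (hF : (F : Set E3) = {B 0, B 1, B 2}) (q : Poly3) :
    IntegrableOn (pval q) (hull F) surfaceMeasure := by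
  have : IsFiniteMeasure (surfaceMeasure.restrict (hull F)) :=
    isFiniteMeasure_restrict.2 (surfaceMeasure_hull_lt_top hF).ne
  obtain ⟨C, hC⟩ := (isCompact_hull F).exists_bound_of_continuousOn (continuous_pval q).continuousOn
  exact Integrable.of_bound (continuous_pval q).aestronglyMeasurable C
    ((ae_restrict_mem (isCompact_hull F).measurableSet).mono hC)

/-- The parametrization is antilipschitz, so a surface-null set pulls back to a Lebesgue-null set of
parameters. The polynomial then vanishes on the open parameter triangle `U`, hence on the whole
plane. -/
theorem pval_eq_zero_of_ae_face (hF : (F : Set E3) = {B 0, B 1, B 2}) {q : Poly3}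
    (h : ∀ᵐ x ∂(surfaceMeasure.restrict (hull F)), pval q x = 0) (y : Fin 2 → ℝ) :
    pval q (B 0 + planeMap B y) = 0 := by
  set φ : (Fin 2 → ℝ) → E3 := fun y => B 0 + planeMap B y with hφ
  let U : Set (Fin 2 → ℝ) := {y | 0 < y 0 ∧ 0 < y 1 ∧ y 0 + y 1 < 1}
  have hU : IsOpen U := by
    have h0 : IsOpen {y : Fin 2 → ℝ | 0 < y 0} := isOpen_lt continuous_const (continuous_apply 0)
    have h1 : IsOpen {y : Fin 2 → ℝ | 0 < y 1} := isOpen_lt continuous_const (continuous_apply 1)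
    have h2 : IsOpen {y : Fin 2 → ℝ | y 0 + y 1 < 1} :=
      isOpen_lt ((continuous_apply 0).add (continuous_apply 1)) continuous_const
    exact h0.inter (h1.inter h2)
  have hUne : U.Nonempty := ⟨![1 / 4, 1 / 4], by norm_num [U]⟩
  have hφU : ∀ y ∈ U, φ y ∈ hull F := by
    rintro y ⟨h0, h1, h2⟩
    have hmem (i : Fin 3) : ![B 0, B 1, B 2] i ∈ hull F := by
      refine subset_convexHull ℝ _ ?_
      rw [hF]
      fin_cases i
      · exact Or.inl rfl
      · exact Or.inr (Or.inl rfl)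
      · exact Or.inr (Or.inr rfl)
    have := (convex_convexHull ℝ (F : Set E3)).sum_mem (t := Finset.univ)
      (w := ![1 - y 0 - y 1, y 0, y 1]) (z := ![B 0, B 1, B 2]) ?_ ?_ fun i _ => hmem i
    · have hy : φ y = (1 - y 0 - y 1) • B 0 + y 0 • B 1 + y 1 • B 2 := by
        simp only [hφ, planeMap_apply]
        module
      rw [Fin.sum_univ_three] at this
      exact hy ▸ this
    · intro i _
      fin_cases i <;> simp <;> linarith
    · simp only [Fin.sum_univ_three, Matrix.cons_val_zero, Matrix.cons_val_one, Matrix.cons_val]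
      ring
  have hcont : Continuous fun y => pval q (φ y) :=
    (continuous_pval q).comp (continuous_const.add (planeMap B).continuous)
  have hnull : volume (U ∩ {y | pval q (φ y) ≠ 0}) = 0 := by
    obtain ⟨K, hK⟩ := antilipschitz_plane (B := B)
    have h1 : surfaceMeasure (hull F ∩ {x | pval q x ≠ 0}) = 0 := by
      rw [ae_restrict_iff' (isCompact_hull F).measurableSet, ae_iff] at h
      convert h using 2
      ext x
      simp
    rw [surfaceMeasure, Measure.euclideanHausdorffMeasure_def, Measure.smul_apply,
      ENNReal.smul_def, smul_eq_mul, mul_eq_zero] at h1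
    -- The normalizing factor of the surface measure is nonzero, so null sets for it are null for
    -- `μH[2]`.
    have h2 := h1.resolve_left (by
      simpa using Measure.addHaarScalarFactor_volume_hausdorffMeasure_ne_zero 2)
    rw [← hausdorffMeasure_two_eq_volume]
    refine le_antisymm ((hK.le_hausdorffMeasure_image zero_le_two _).trans ?_) zero_le
    have h3 : φ '' (U ∩ {y | pval q (φ y) ≠ 0}) ⊆ hull F ∩ {x | pval q x ≠ 0} := by
      rintro _ ⟨y, ⟨hyU, hy⟩, rfl⟩
      exact ⟨hφU y hyU, hy⟩
    have h4 : μH[2] (φ '' (U ∩ {y | pval q (φ y) ≠ 0})) = 0 := measure_mono_null h3 h2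
    rw [h4, mul_zero]
  have hEq : Set.EqOn (fun y => pval q (φ y)) 0 U := by
    refine Measure.eqOn_open_of_ae_eq (μ := volume) ?_ hU hcont.continuousOn continuousOn_const
    rw [Filter.EventuallyEq, ae_restrict_iff' hU.measurableSet, ae_iff]
    convert hnull using 2
    ext y
    simp
  exact pval_comp_eq_zero _ _ q hU hUne hEq y

end PolynomialIntegrals

/-! ### Algebra of the inner products -/

section InnerProducts

variable (T : Finset E3)

theorem innerS_eq (p q : Poly3) : innerS T p q = cellInt T (p * q) := by
  simp only [innerS, ← pval_mul]
  rfl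

theorem innerV_eq (u v : Fin 3 → Poly3) : innerV T u v = ∑ i, cellInt T (u i * v i) := by
  rw [← map_sum, innerV]
  simp only [← pval_mul, ← pval_sum]
  rfl

theorem innerM_eq (L G : Matrix (Fin 3) (Fin 3) Poly3) :
    innerM T L G = ∑ i, ∑ j, cellInt T (L i j * G i j) := by
  simp only [← map_sum, innerM, ← pval_mul, ← pval_sum]
  rfl

/-- `innerS` as a bilinear form. -/
def formS : Poly3 →ₗ[ℝ] Poly3 →ₗ[ℝ] ℝ := (LinearMap.mul ℝ Poly3).compr₂ (cellInt T)

/-- `innerV` as a bilinear form. -/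
def formV : (Fin 3 → Poly3) →ₗ[ℝ] (Fin 3 → Poly3) →ₗ[ℝ] ℝ :=
  ∑ i, (formS T).compl₁₂ (LinearMap.proj i) (LinearMap.proj i)

/-- `innerM` as a bilinear form. -/
def formM : Matrix (Fin 3) (Fin 3) Poly3 →ₗ[ℝ] Matrix (Fin 3) (Fin 3) Poly3 →ₗ[ℝ] ℝ :=
  ∑ i, (formV T).compl₁₂ (LinearMap.proj (φ := fun _ : Fin 3 => Fin 3 → Poly3) i)
    (LinearMap.proj (φ := fun _ : Fin 3 => Fin 3 → Poly3) i)

theorem innerS_eq_form (p q : Poly3) : innerS T p q = formS T p q := innerS_eq T p q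

theorem innerV_eq_form (u v : Fin 3 → Poly3) : innerV T u v = formV T u v := by
  rw [innerV_eq]
  simp [formV, formS, LinearMap.sum_apply]

theorem innerM_eq_form (L G : Matrix (Fin 3) (Fin 3) Poly3) : innerM T L G = formM T L G := by
  rw [innerM_eq]
  simp only [formM, LinearMap.sum_apply]
  exact Finset.sum_congr rfl fun i _ =>
    (innerV_eq T (L.row i) (G.row i)).symm.trans (innerV_eq_form T _ _)

theorem innerV_comm (u v : Fin 3 → Poly3) : innerV T u v = innerV T v u := by
  simp only [innerV, mul_comm]

theorem innerS_self_nonneg (q : Poly3) : 0 ≤ innerS T q q := by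
  rw [innerS_eq]
  exact cellInt_sq_nonneg T q

theorem innerM_self_nonneg (L : Matrix (Fin 3) (Fin 3) Poly3) : 0 ≤ innerM T L L := by
  rw [innerM_eq]
  exact Finset.sum_nonneg fun i _ => Finset.sum_nonneg fun j _ => cellInt_sq_nonneg T _

variable {T} {B : AffineBasis (Fin 4) ℝ E3}

theorem eq_zero_of_innerV_self (hT : (T : Set E3) = Set.range B) {u : Fin 3 → Poly3}
    (h : innerV T u u = 0) : u = 0 := by
  rw [innerV_eq, Finset.sum_eq_zero_iff_of_nonneg fun i _ => cellInt_sq_nonneg T _] at h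
  exact funext fun i => eq_zero_of_cellInt_sq hT (h i (Finset.mem_univ i))

theorem eq_zero_of_innerM_self (hT : (T : Set E3) = Set.range B)
    {L : Matrix (Fin 3) (Fin 3) Poly3} (h : innerM T L L = 0) : L = 0 := by
  rw [innerM_eq] at h
  ext1 i j
  have h1 := (Finset.sum_eq_zero_iff_of_nonneg fun i _ =>
    Finset.sum_nonneg fun j _ => cellInt_sq_nonneg T (L i j)).1 h i (Finset.mem_univ i)
  have h2 := (Finset.sum_eq_zero_iff_of_nonneg fun j _ => cellInt_sq_nonneg T (L i j)).1 h1 j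
    (Finset.mem_univ j)
  exact eq_zero_of_cellInt_sq hT h2

end InnerProducts

/-! ### Linearity of the differential operators and solvability in finite dimension -/

theorem divergence_add (G H : Matrix (Fin 3) (Fin 3) Poly3) :
    divergence (G + H) = divergence G + divergence H := by
  ext1 i
  simp [divergence, Finset.sum_add_distrib]

theorem divergence_smul (c : ℝ) (G : Matrix (Fin 3) (Fin 3) Poly3) :
    divergence (c • G) = c • divergence G := by
  ext1 i
  simp [divergence, Finset.smul_sum]

theorem divergence_sub (G H : Matrix (Fin 3) (Fin 3) Poly3) :
    divergence (G - H) = divergence G - divergence H := by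
  ext1 i
  simp [divergence]

theorem grad_add (p q : Poly3) : grad (p + q) = grad p + grad q := by
  ext1 i
  simp [grad]

theorem grad_smul (c : ℝ) (p : Poly3) : grad (c • p) = c • grad p := by
  ext1 i
  simp [grad]

theorem grad_sub (p q : Poly3) : grad (p - q) = grad p - grad q := by
  ext1 i
  simp [grad]

theorem divergence_zero : divergence 0 = 0 := by simpa using divergence_smul 0 0

theorem grad_zero : grad 0 = 0 := by simpa using grad_smul 0 0

/-- A space and its dual have equal finite dimension, so a trivial kernel makes `E → E*` onto. -/
theorem exists_form_eq {E : Type*} [AddCommGroup E] [Module ℝ E] [FiniteDimensional ℝ E]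
    (b : E →ₗ[ℝ] E →ₗ[ℝ] ℝ) (hb : ∀ x, (∀ y, b x y = 0) → x = 0) (f : E →ₗ[ℝ] ℝ) :
    ∃ x, ∀ y, b x y = f y := by
  have hinj : Function.Injective b := (injective_iff_map_eq_zero b).2 fun x hx =>
    hb x fun y => by rw [hx, LinearMap.zero_apply]
  have hsurj := (LinearMap.injective_iff_surjective_of_finrank_eq_finrank
    (Subspace.dual_finrank_eq (K := ℝ) (V := E)).symm).1 hinj
  obtain ⟨x, hx⟩ := hsurj f
  exact ⟨x, fun y => by rw [hx]⟩

/-- The weighted Riesz representation in a polynomial space. -/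
theorem exists_weighted_riesz {T : Finset E3} {ω : Poly3}
    (hω : ∀ q, cellInt T (ω * q * q) = 0 → q = 0) (k : ℤ) (f : Poly3 →ₗ[ℝ] ℝ) :
    ∃ w ∈ polySpace k, ∀ v ∈ polySpace k, cellInt T (ω * w * v) = f v := by
  have : FiniteDimensional ℝ (polySpace k) := Module.Finite.iff_fg.2 (polySpace_fg k)
  let b : polySpace k →ₗ[ℝ] polySpace k →ₗ[ℝ] ℝ :=
    (formS T).compl₁₂ ((LinearMap.mulLeft ℝ ω).comp (polySpace k).subtype) (polySpace k).subtype
  obtain ⟨w, hw⟩ := exists_form_eq b (fun x hx => Subtype.ext (hω x (hx x)))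
    (f.comp (polySpace k).subtype)
  exact ⟨w, w.2, fun v hv => hw ⟨v, hv⟩⟩

/-! ### Boundary integrals -/

/-- The polynomials are integrable over the faces of `T`. -/
def FaceIntegrable (T : Finset E3) : Prop :=
  ∀ F ∈ facesOf T, ∀ q, IntegrableOn (pval q) (hull F) surfaceMeasure

/-- The field `lam` agrees almost everywhere on each face `F` of `T` with the polynomial
field `r F`. -/
def IsTrace (T : Finset E3) (lam : E3 → E3) (r : Finset E3 → Fin 3 → Poly3) : Prop :=
  ∀ F ∈ facesOf T, ∀ᵐ x ∂(surfaceMeasure.restrict (hull F)), ∀ i, lam x i = pval (r F i) x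

/-- The boundary integral of facewise polynomials. -/
def polyBoundary (T : Finset E3) (g : Finset E3 → Poly3) : ℝ :=
  boundaryIntegral T fun F => pval (g F)

section Boundary

variable {T : Finset E3}

/-- Replacing `lam` by its facewise polynomials makes every boundary integrand a polynomial, hence
integrable, so that boundary integrals become linear. -/
theorem boundaryIntegral_eq_polyBoundary {h : Finset E3 → E3 → ℝ} {g : Finset E3 → Poly3}
    (hg : ∀ F ∈ facesOf T, ∀ᵐ x ∂(surfaceMeasure.restrict (hull F)), h F x = pval (g F) x) :
    boundaryIntegral T h = polyBoundary T g :=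
  Finset.sum_congr rfl fun F hF => integral_congr_ae (hg F hF)

theorem boundaryIntegral_eq_zero {h : Finset E3 → E3 → ℝ}
    (hh : ∀ F ∈ facesOf T, ∀ᵐ x ∂(surfaceMeasure.restrict (hull F)), h F x = 0) :
    boundaryIntegral T h = 0 :=
  Finset.sum_eq_zero fun F hF => integral_eq_zero_of_ae (hh F hF)

theorem polyBoundary_add (hT : FaceIntegrable T) (g g' : Finset E3 → Poly3) :
    polyBoundary T (g + g') = polyBoundary T g + polyBoundary T g' := by
  rw [polyBoundary, polyBoundary, polyBoundary, boundaryIntegral, boundaryIntegral,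
    boundaryIntegral, ← Finset.sum_add_distrib]
  refine Finset.sum_congr rfl fun F hF => ?_
  rw [← integral_add (hT F hF _) (hT F hF _)]
  simp only [Pi.add_apply, pval_add]

theorem polyBoundary_sub (hT : FaceIntegrable T) (g g' : Finset E3 → Poly3) :
    polyBoundary T (g - g') = polyBoundary T g - polyBoundary T g' := by
  rw [eq_sub_iff_add_eq, ← polyBoundary_add hT, sub_add_cancel]

theorem polyBoundary_smul (c : ℝ) (g : Finset E3 → Poly3) :
    polyBoundary T (c • g) = c * polyBoundary T g := by
  rw [polyBoundary, polyBoundary, boundaryIntegral, boundaryIntegral, Finset.mul_sum]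
  refine Finset.sum_congr rfl fun F _ => ?_
  simp only [Pi.smul_apply, pval_smul]
  exact integral_const_mul _ _

theorem polyBoundary_zero : polyBoundary T 0 = 0 := by simpa using polyBoundary_smul (T := T) 0 0

variable {lam : E3 → E3} {r : Finset E3 → Fin 3 → Poly3}

/-- The integrand `lam · G ν`. -/
def gradientData (T : Finset E3) (r : Finset E3 → Fin 3 → Poly3)
    (G : Matrix (Fin 3) (Fin 3) Poly3) (F : Finset E3) : Poly3 :=
  ∑ i, r F i * ∑ j, G i j * MvPolynomial.C (outerNormal T F j)

/-- The integrand `(lam · ν) q`. -/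
def balanceData (T : Finset E3) (r : Finset E3 → Fin 3 → Poly3) (q : Poly3)
    (F : Finset E3) : Poly3 :=
  (∑ i, r F i * MvPolynomial.C (outerNormal T F i)) * q

/-- The integrand `S (u - lam) · v`. -/
def stabData (τ : Finset E3 → ℝ) (r : Finset E3 → Fin 3 → Poly3) (u v : Fin 3 → Poly3)
    (F : Finset E3) : Poly3 :=
  ∑ i, MvPolynomial.C (τ F) * (u i - r F i) * v i

theorem boundaryIntegral_gradient (hr : IsTrace T lam r) (G : Matrix (Fin 3) (Fin 3) Poly3) :
    (boundaryIntegral T fun F x => ∑ i, lam x i * ∑ j, pval (G i j) x * outerNormal T F j) =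
      polyBoundary T (gradientData T r G) :=
  boundaryIntegral_eq_polyBoundary fun F hF => (hr F hF).mono fun x hx => by
    simp only [gradientData, pval_sum, pval_mul, pval_C, hx]

theorem boundaryIntegral_balance (hr : IsTrace T lam r) (q : Poly3) :
    (boundaryIntegral T fun F x => (∑ i, lam x i * outerNormal T F i) * pval q x) =
      polyBoundary T (balanceData T r q) :=
  boundaryIntegral_eq_polyBoundary fun F hF => (hr F hF).mono fun x hx => by
    simp only [balanceData, pval_sum, pval_mul, pval_C, hx]

theorem boundaryIntegral_stab (hr : IsTrace T lam r) (τ : Finset E3 → ℝ) (u v : Fin 3 → Poly3) :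
    (boundaryIntegral T fun F x => ∑ i, τ F * (pval (u i) x - lam x i) * pval (v i) x) =
      polyBoundary T (stabData τ r u v) :=
  boundaryIntegral_eq_polyBoundary fun F hF => (hr F hF).mono fun x hx => by
    simp only [stabData, pval_sum, pval_mul, pval_sub, pval_C, hx]

theorem isTrace_zero : IsTrace T 0 0 := fun _ _ => .of_forall fun _ _ => by simp [pval]

theorem gradientData_add (G H : Matrix (Fin 3) (Fin 3) Poly3) :
    gradientData T r (G + H) = gradientData T r G + gradientData T r H := by
  ext1 F
  simp [gradientData, add_mul, mul_add, Finset.sum_add_distrib]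

theorem gradientData_smul (c : ℝ) (G : Matrix (Fin 3) (Fin 3) Poly3) :
    gradientData T r (c • G) = c • gradientData T r G := by
  ext1 F
  simp only [gradientData, Matrix.smul_apply, smul_mul_assoc, ← Finset.smul_sum, mul_smul_comm,
    Pi.smul_apply]

theorem balanceData_add (p q : Poly3) :
    balanceData T r (p + q) = balanceData T r p + balanceData T r q := by
  ext1 F
  simp [balanceData, mul_add]

theorem balanceData_smul (c : ℝ) (q : Poly3) :
    balanceData T r (c • q) = c • balanceData T r q := by
  ext1 F
  simp [balanceData]

theorem gradientData_zero : gradientData T r 0 = 0 := by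
  simpa using gradientData_smul (T := T) (r := r) 0 0

theorem balanceData_zero : balanceData T r 0 = 0 := by
  simpa using balanceData_smul (T := T) (r := r) 0 0

/-- The stabilization is affine in `u`; the trace cancels in a difference, which leaves the term for
zero data. -/
theorem stabData_sub (τ : Finset E3 → ℝ) (u u' v : Fin 3 → Poly3) :
    stabData τ 0 (u - u') v = stabData τ r u v - stabData τ r u' v := by
  ext1 F
  simp only [stabData, Pi.sub_apply, Pi.zero_apply, ← Finset.sum_sub_distrib]
  refine Finset.sum_congr rfl fun i _ => ?_
  ring

end Boundary

/-! ### Uniqueness -/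

instance : Sub LocalTriple := ⟨fun s t => ⟨s.L - t.L, s.u - t.u, s.p - t.p⟩⟩

section Uniqueness

variable {T : Finset E3} {m : Method} {dt : ℝ} {lam : E3 → E3} {r : Finset E3 → Fin 3 → Poly3}

theorem IsLocalSolution.sub (hT : FaceIntegrable T) (hr : IsTrace T lam r) {s t : LocalTriple}
    (hs : IsLocalSolution m dt T lam s) (ht : IsLocalSolution m dt T lam t) :
    IsLocalSolution m dt T 0 (s - t) where
  L_mem := m.W.sub_mem hs.L_mem ht.L_mem
  u_mem := m.V.sub_mem hs.u_mem ht.u_mem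
  p_mem := m.Q.sub_mem hs.p_mem ht.p_mem
  gradient_eq G hG := by
    have h1 := hs.gradient_eq G hG
    have h2 := ht.gradient_eq G hG
    rw [boundaryIntegral_eq_zero fun F _ => .of_forall fun x => by simp]
    change innerM T (s.L - t.L) G + innerV T (s.u - t.u) _ = 0
    simp only [innerM_eq_form, innerV_eq_form, map_sub, LinearMap.sub_apply] at h1 h2 ⊢
    linarith
  momentum_eq v hv := by
    have h1 := hs.momentum_eq v hv
    have h2 := ht.momentum_eq v hv
    rw [boundaryIntegral_stab hr] at h1 h2
    rw [boundaryIntegral_stab isTrace_zero]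
    change innerV T (-divergence (s.L - t.L) + grad (s.p - t.p)) v +
      polyBoundary T (stabData _ 0 (s.u - t.u) v) = 0
    rw [stabData_sub (r := r), polyBoundary_sub hT, divergence_sub, grad_sub]
    simp only [innerV_eq_form, map_sub, map_neg, map_add, LinearMap.sub_apply, LinearMap.add_apply,
      LinearMap.neg_apply] at h1 h2 ⊢
    linarith
  balance_eq q hq := by
    have h1 := hs.balance_eq q hq
    have h2 := ht.balance_eq q hq
    rw [boundaryIntegral_eq_zero fun F _ => .of_forall fun x => by simp]
    change 1 / dt * innerS T (s.p - t.p) q - innerV T (s.u - t.u) _ = -0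
    simp only [innerS_eq_form, innerV_eq_form, map_sub, LinearMap.sub_apply] at h1 h2 ⊢
    linarith

theorem IsLocalSolution.eq_of_sub {s t : LocalTriple} (hL : (s - t).L = 0) (hu : (s - t).u = 0)
    (hp : (s - t).p = 0) : s = t := by
  obtain ⟨L, u, p⟩ := s
  obtain ⟨L', u', p'⟩ := t
  obtain rfl : L = L' := sub_eq_zero.1 hL
  obtain rfl : u = u' := sub_eq_zero.1 hu
  obtain rfl : p = p' := sub_eq_zero.1 hp
  rfl

variable {B : AffineBasis (Fin 4) ℝ E3} {s : LocalTriple}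

/-- The energy identity for the homogeneous element-local problem. -/
theorem IsLocalSolution.energy (hs : IsLocalSolution m dt T 0 s) :
    innerM T s.L s.L + 1 / dt * innerS T s.p s.p +
      polyBoundary T (stabData (m.stab T) 0 s.u s.u) = 0 := by
  -- Test with the solution itself and add: the terms `(u, ∇·L)` and `(u, ∇p)` cancel.
  have h1 := hs.gradient_eq s.L hs.L_mem
  have h2 := hs.momentum_eq s.u hs.u_mem
  have h3 := hs.balance_eq s.p hs.p_mem
  rw [boundaryIntegral_eq_zero fun F _ => .of_forall fun x => by simp, innerV_comm] at h1 h3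
  rw [boundaryIntegral_stab isTrace_zero] at h2
  simp only [innerV_eq_form, map_neg, map_add, LinearMap.add_apply,
      LinearMap.neg_apply] at h1 h2 h3
  linarith

theorem pval_stabData_zero (τ : Finset E3 → ℝ) (u : Fin 3 → Poly3) (F : Finset E3) (x : E3) :
    pval (stabData τ 0 u u F) x = τ F * ∑ i, pval (u i) x * pval (u i) x := by
  simp [stabData, pval_sum, pval_mul, pval_C, Finset.mul_sum, mul_assoc]

/-- The three terms of the energy identity are nonnegative, so each is zero. With `L = 0` the
gradient equation reduces to orthogonality of `u` to the divergences. -/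
theorem IsLocalSolution.homogeneous (hB : (T : Set E3) = Set.range B) (hT : FaceIntegrable T)
    (hdt : 0 < dt) (hm : ∀ F, 0 ≤ m.stab T F) (hs : IsLocalSolution m dt T 0 s) :
    s.L = 0 ∧ s.p = 0 ∧ (∀ G ∈ m.W, innerV T s.u (divergence G) = 0) ∧
      ∀ F ∈ facesOf T, m.stab T F ≠ 0 →
        ∀ i, ∀ᵐ x ∂(surfaceMeasure.restrict (hull F)), pval (s.u i) x = 0 := by
  have h := hs.energy
  have hnn (F : Finset E3) (x : E3) : 0 ≤ pval (stabData (m.stab T) 0 s.u s.u F) x := by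
    rw [pval_stabData_zero]
    exact mul_nonneg (hm F) (Finset.sum_nonneg fun i _ => mul_self_nonneg _)
  have hFnn : ∀ F ∈ facesOf T,
      0 ≤ ∫ x in hull F, pval (stabData (m.stab T) 0 s.u s.u F) x ∂surfaceMeasure :=
    fun F _ => integral_nonneg (hnn F)
  have hbd : 0 ≤ polyBoundary T (stabData (m.stab T) 0 s.u s.u) := Finset.sum_nonneg hFnn
  have hL := innerM_self_nonneg T s.L
  have hp := innerS_self_nonneg T s.p
  have hp' : 0 ≤ 1 / dt * innerS T s.p s.p := by positivity
  have hL0 : s.L = 0 := eq_zero_of_innerM_self hB (by linarith)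
  have hp0 : s.p = 0 := by
    have : 1 / dt * innerS T s.p s.p = 0 := by linarith
    rw [mul_eq_zero, innerS_eq] at this
    exact eq_zero_of_cellInt_sq hB (this.resolve_left (by positivity))
  refine ⟨hL0, hp0, fun G hG => ?_, fun F hF hτ i => ?_⟩
  · have h1 := hs.gradient_eq G hG
    rw [boundaryIntegral_eq_zero fun F _ => .of_forall fun x => by simp, hL0, innerM_eq_form,
      map_zero, LinearMap.zero_apply, zero_add] at h1
    exact h1
  · have h1 : polyBoundary T (stabData (m.stab T) 0 s.u s.u) = 0 := by linarith
    have h2 := (Finset.sum_eq_zero_iff_of_nonneg hFnn).1 h1 F hF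
    have h3 := (integral_eq_zero_iff_of_nonneg (hnn F) (hT F hF _)).1 h2
    filter_upwards [h3] with x hx
    rw [pval_stabData_zero, Pi.zero_apply, mul_eq_zero] at hx
    have h4 := hx.resolve_left hτ
    rw [Finset.sum_eq_zero_iff_of_nonneg fun i _ => mul_self_nonneg _] at h4
    exact mul_self_eq_zero.1 (h4 i (Finset.mem_univ i))

/-- If the divergence reaches all of `V`, then `u` is itself a divergence and so orthogonal to
itself. -/
theorem IsLocalSolution.u_eq_zero (hB : (T : Set E3) = Set.range B) (hT : FaceIntegrable T)
    (hdt : 0 < dt) (hm : ∀ F, 0 ≤ m.stab T F)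
    (hdiv : ∀ v ∈ m.V, ∃ G ∈ m.W, divergence G = v) (hs : IsLocalSolution m dt T 0 s) :
    s.u = 0 := by
  obtain ⟨G, hG, h⟩ := hdiv s.u hs.u_mem
  have := (hs.homogeneous hB hT hdt hm).2.2.1 G hG
  rw [h] at this
  exact eq_zero_of_innerV_self hB this

theorem sfh_stab_nonneg {p : ℕ} {τ : ℝ} (hτ : 0 < τ) (Fstar : Finset E3 → Finset E3)
    (T F : Finset E3) : 0 ≤ (sfh p τ Fstar).stab T F := by
  simp only [sfh]
  split_ifs
  exacts [hτ.le, le_rfl]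

/-- Here divergences reach only degree `p - 1`, one short of `V`. The stabilized face makes up for
it: `u` vanishes there, so `u = ℓ w` with `w` of degree at most `p - 1`, and `w` is a divergence.
Orthogonality then reads `∫ ℓ |w|² = 0`. -/
theorem IsLocalSolution.u_eq_zero_sfh {p : ℕ} {τ : ℝ} {Fstar : Finset E3 → Finset E3}
    (hB : (T : Set E3) = Set.range B) (hF : (Fstar T : Set E3) = {B 0, B 1, B 2})
    (hT : FaceIntegrable T) (hdt : 0 < dt) (hτ : 0 < τ) (hFstar : Fstar T ∈ facesOf T)
    (hs : IsLocalSolution (sfh p τ Fstar) dt T 0 s) : s.u = 0 := by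
  obtain ⟨-, -, horth, hface⟩ := hs.homogeneous hB hT hdt (sfh_stab_nonneg hτ Fstar T)
  have hu : s.u ∈ vecPolySpace p := hs.u_mem
  have hzero := hface _ hFstar (by simpa [sfh] using hτ.ne')
  choose w hw hlw using fun i => exists_eq_coordPoly_mul B (mem_vecPolySpace.1 hu i)
    (pval_eq_zero_of_ae_face hF (hzero i))
  obtain ⟨G, hG, hdiv⟩ := exists_divergence_eq_of_vecPolySpace (mem_vecPolySpace.2 hw)
  have h := horth G hG
  rw [hdiv, innerV_eq] at h
  simp only [hlw] at h
  have hnn (i : Fin 3) : 0 ≤ cellInt T (coordPoly B * w i * w i) :=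
    setIntegral_nonneg (isCompact_hull T).measurableSet fun x hx => by
      rw [pval_mul, pval_mul, mul_assoc, pval_coordPoly]
      rw [hull_eq_of_range hB] at hx
      exact mul_nonneg (hx 3) (mul_self_nonneg _)
  rw [Finset.sum_eq_zero_iff_of_nonneg fun i _ => hnn i] at h
  ext1 i
  rw [hlw, eq_zero_of_cellInt_coordPoly hB (h i (Finset.mem_univ i)), mul_zero]
  rfl

end Uniqueness

/-! ### Existence -/

theorem rowwise_fg {R : Submodule ℝ (Fin 3 → Poly3)} (hR : R.FG) : (rowwise R).FG := by
  have : rowwise R = Submodule.pi Set.univ fun _ : Fin 3 => R :=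
    SetLike.ext fun G => (show G ∈ rowwise R ↔ ∀ i, G i ∈ R from Iff.rfl).trans
      (Iff.trans ⟨fun h i _ => h i, fun h i => h i trivial⟩ Submodule.mem_pi.symm)
  rw [this]
  exact Submodule.fg_pi fun _ => hR

section Existence

variable {T : Finset E3} {dt : ℝ} {lam : E3 → E3} {r : Finset E3 → Fin 3 → Poly3}
  {B : AffineBasis (Fin 4) ℝ E3}

/-- The bilinear form of the element-local problem without stabilization. -/
def localForm (m : Method) (dt : ℝ) (T : Finset E3) :
    (m.W × m.V × m.Q) →ₗ[ℝ] (m.W × m.V × m.Q) →ₗ[ℝ] ℝ :=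
  LinearMap.mk₂ ℝ (fun s t =>
    formM T s.1 t.1 + formV T s.2.1 (divergence t.1) +
      formV T (-divergence s.1 + grad s.2.2) t.2.1 +
      (1 / dt * formS T s.2.2 t.2.2 - formV T s.2.1 (grad t.2.2)))
    (fun s s' t => by
      simp only [Prod.fst_add, Prod.snd_add, Submodule.coe_add, divergence_add, grad_add, map_add,
        map_neg, LinearMap.add_apply, LinearMap.neg_apply]
      ring)
    (fun c s t => by
      simp only [Prod.smul_fst, Prod.smul_snd, Submodule.coe_smul, divergence_smul, grad_smul,
        map_add, map_neg, map_smul, LinearMap.add_apply, LinearMap.neg_apply, LinearMap.smul_apply,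
        smul_eq_mul]
      ring)
    (fun s t t' => by
      simp only [Prod.fst_add, Prod.snd_add, Submodule.coe_add, divergence_add, grad_add, map_add]
      ring)
    (fun c s t => by
      simp only [Prod.smul_fst, Prod.smul_snd, Submodule.coe_smul, divergence_smul, grad_smul,
        map_smul, smul_eq_mul]
      ring)

theorem localForm_apply (m : Method) (s t : m.W × m.V × m.Q) :
    localForm m dt T s t = innerM T s.1 t.1 + innerV T s.2.1 (divergence t.1) +
      innerV T (-divergence (s.1 : Matrix (Fin 3) (Fin 3) Poly3) + grad s.2.2) t.2.1 +
      (1 / dt * innerS T s.2.2 t.2.2 - innerV T s.2.1 (grad t.2.2)) := by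
  simp only [innerM_eq_form, innerV_eq_form, innerS_eq_form]
  rfl

/-- The right-hand side of the element-local problem without stabilization. -/
def localData (m : Method) (hT : FaceIntegrable T) (r : Finset E3 → Fin 3 → Poly3) :
    (m.W × m.V × m.Q) →ₗ[ℝ] ℝ where
  toFun t := polyBoundary T (gradientData T r t.1) - polyBoundary T (balanceData T r t.2.2)
  map_add' s t := by
    simp only [Prod.fst_add, Prod.snd_add, Submodule.coe_add, gradientData_add, balanceData_add,
      polyBoundary_add hT]
    ring
  map_smul' c t := by
    simp only [Prod.smul_fst, Prod.smul_snd, Submodule.coe_smul, gradientData_smul,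
      balanceData_smul, polyBoundary_smul, RingHom.id_apply, smul_eq_mul]
    ring

/-- Test triples with a single nonzero component separate the summed equation into the three
original ones. -/
theorem isLocalSolution_of_localForm {m : Method} (hm : ∀ F, m.stab T F = 0)
    (hT : FaceIntegrable T) (hr : IsTrace T lam r) {s : m.W × m.V × m.Q}
    (hs : ∀ t, localForm m dt T s t = localData m hT r t) :
    IsLocalSolution m dt T lam ⟨s.1, s.2.1, s.2.2⟩ where
  L_mem := s.1.2
  u_mem := s.2.1.2
  p_mem := s.2.2.2
  gradient_eq G hG := by
    have h := hs (⟨G, hG⟩, 0, 0)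
    rw [localForm_apply] at h
    rw [boundaryIntegral_gradient hr]
    simp only [localData, LinearMap.coe_mk, AddHom.coe_mk, ZeroMemClass.coe_zero, innerV_eq_form,
      innerS_eq_form, innerM_eq_form, map_zero, grad_zero, balanceData_zero, polyBoundary_zero] at h ⊢
    linarith
  momentum_eq v hv := by
    have h := hs (0, ⟨v, hv⟩, 0)
    rw [localForm_apply] at h
    rw [boundaryIntegral_eq_zero fun F _ => .of_forall fun x => by simp [hm]]
    simp only [localData, LinearMap.coe_mk, AddHom.coe_mk, ZeroMemClass.coe_zero, innerV_eq_form,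
      innerS_eq_form, innerM_eq_form, map_zero, grad_zero, divergence_zero, gradientData_zero,
      balanceData_zero, polyBoundary_zero] at h ⊢
    linarith
  balance_eq q hq := by
    have h := hs (0, 0, ⟨q, hq⟩)
    rw [localForm_apply] at h
    rw [boundaryIntegral_balance hr]
    simp only [localData, LinearMap.coe_mk, AddHom.coe_mk, ZeroMemClass.coe_zero, innerV_eq_form,
      innerS_eq_form, innerM_eq_form, map_zero, divergence_zero, gradientData_zero,
      polyBoundary_zero] at h ⊢
    linarith

/-- A square linear system: a kernel element of the form solves the problem with zero data, which
has only the zero solution. -/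
theorem exists_isLocalSolution_rtH (p : ℕ) (hdt : 0 < dt) (hB : (T : Set E3) = Set.range B)
    (hT : FaceIntegrable T) (hr : IsTrace T lam r) :
    ∃ s, IsLocalSolution (rtH p) dt T lam s := by
  have h1 : FiniteDimensional ℝ (rtH p).W :=
    Module.Finite.iff_fg.2 (rowwise_fg (raviartThomas_fg p))
  have h2 : FiniteDimensional ℝ (rtH p).V := Module.Finite.iff_fg.2 (vecPolySpace_fg p)
  have h3 : FiniteDimensional ℝ (rtH p).Q := Module.Finite.iff_fg.2 (polySpace_fg p)
  have hinj : ∀ s, (∀ t, localForm (rtH p) dt T s t = 0) → s = 0 := by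
    intro s hs
    have h0 : IsLocalSolution (rtH p) dt T 0 ⟨s.1, s.2.1, s.2.2⟩ :=
      isLocalSolution_of_localForm (fun _ => rfl) hT isTrace_zero fun t => by
        have hg : gradientData T 0 t.1 = 0 := by
          ext1 F
          simp [gradientData]
        have hb : balanceData T 0 t.2.2 = 0 := by
          ext1 F
          simp [balanceData]
        rw [hs]
        simp only [localData, LinearMap.coe_mk, AddHom.coe_mk, hg, hb, sub_self]
    obtain ⟨hL, hp, -⟩ := h0.homogeneous hB hT hdt fun _ => le_rfl
    have hu := h0.u_eq_zero hB hT hdt (fun _ => le_rfl)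
      fun v hv => exists_divergence_eq_of_raviartThomas hv
    exact Prod.ext (Subtype.ext hL) (Prod.ext (Subtype.ext hu) (Subtype.ext hp))
  obtain ⟨s, hs⟩ := exists_form_eq (localForm (rtH p) dt T) hinj (localData (rtH p) hT r)
  exact ⟨_, isLocalSolution_of_localForm (fun _ => rfl) hT hr hs⟩

/-! ### Comparison of the methods -/

/-- Both terms of the residual `-∇·L + ∇p` have degree at most `p`, so the momentum equation may be
tested with the residual itself. -/
theorem divergence_eq_grad {p : ℕ} (hB : (T : Set E3) = Set.range B) {s : LocalTriple}
    (hs : IsLocalSolution (rtH p) dt T lam s) : divergence s.L = grad s.p := by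
  have hmem : -divergence s.L + grad s.p ∈ (rtH p).V :=
    Submodule.add_mem _ (Submodule.neg_mem _ (divergence_mem_of_raviartThomas hs.L_mem))
      (mem_vecPolySpace.2 fun i =>
        polySpace_mono (by omega) (mem_vecPolySpace.1 (grad_mem hs.p_mem) i))
  have h := hs.momentum_eq _ hmem
  rw [boundaryIntegral_eq_zero fun F _ => .of_forall fun x => by simp [rtH], add_zero] at h
  have h1 := eq_zero_of_innerV_self hB h
  rw [neg_add_eq_zero] at h1
  exact h1

/-- The gradient and the pressure of the Raviart--Thomas method solve the element-local problem
of any method with polynomial spaces, once the velocity has the right moments and agrees with the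
trace where the method is stabilized. -/
theorem IsLocalSolution.transfer {p : ℕ} (hB : (T : Set E3) = Set.range B) {s : LocalTriple}
    (hs : IsLocalSolution (rtH p) dt T lam s) {m : Method} (hW : m.W = rowwise (vecPolySpace p))
    (hQ : m.Q = polySpace p) {u : Fin 3 → Poly3} (hu : u ∈ m.V)
    (hmom : ∀ v ∈ vecPolySpace ((p : ℤ) - 1), innerV T u v = innerV T s.u v)
    (hstab : ∀ F ∈ facesOf T, m.stab T F ≠ 0 →
      ∀ᵐ x ∂(surfaceMeasure.restrict (hull F)), ∀ i, lam x i = pval (u i) x) :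
    IsLocalSolution m dt T lam ⟨s.L, u, s.p⟩ := by
  have hdiv := divergence_eq_grad hB hs
  refine ⟨?_, hu, ?_, fun G hG => ?_, fun v hv => ?_, fun q hq => ?_⟩
  · rw [hW]
    -- The degree of `∇·L = ∇p` is at most `p - 1`, which brings `L` down from Raviart–Thomas to
    -- degree `p`.
    exact mem_rowwise_of_divergence_mem hs.L_mem (hdiv ▸ grad_mem hs.p_mem)
  · rw [hQ]
    exact hs.p_mem
  · rw [hW] at hG
    rw [← hs.gradient_eq G fun i => vecPolySpace_le_raviartThomas p (hG i)]
    exact congrArg _ (hmom _ (divergence_mem_of_vecPolySpace hG))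
  -- The volume and the boundary part of the momentum equation vanish separately: on each face
  -- either `τ = 0` or `u = lam`.
  · rw [boundaryIntegral_eq_zero, hdiv, neg_add_cancel, add_zero, innerV_eq_form, map_zero,
      LinearMap.zero_apply]
    intro F hF
    by_cases h0 : m.stab T F = 0
    · exact .of_forall fun x => by simp [h0]
    · exact (hstab F hF h0).mono fun x hx => by simp [hx]
  · rw [hQ] at hq
    rw [← hs.balance_eq q hq]
    exact congrArg _ (hmom _ (grad_mem hq))

/-- The velocity is the componentwise `L²` projection of the Raviart–Thomas velocity onto degree `p
- 1`. -/
theorem exists_bdmH_of_rtH {p : ℕ} (hB : (T : Set E3) = Set.range B) {s : LocalTriple}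
    (hs : IsLocalSolution (rtH p) dt T lam s) :
    ∃ u, IsLocalSolution (bdmH p) dt T lam ⟨s.L, u, s.p⟩ := by
  choose u hu h using fun i => exists_weighted_riesz (T := T) (ω := 1)
    (fun q hq => eq_zero_of_cellInt_sq hB (by rwa [one_mul] at hq)) ((p : ℤ) - 1)
    (formS T (s.u i))
  refine ⟨u, hs.transfer hB rfl rfl (mem_vecPolySpace.2 hu) (fun v hv => ?_)
    fun F _ h0 => absurd rfl h0⟩
  rw [innerV_eq, innerV_eq]
  refine Finset.sum_congr rfl fun i _ => ?_
  have := h i (v i) (mem_vecPolySpace.1 hv i)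
  rw [one_mul] at this
  exact this

/-- The velocity is `r + ℓ w`: the factor `ℓ` fixes the trace on `F*`, and the weighted Riesz
representation chooses `w` so that `∫ ℓ w v = ∫ (u_RT - r) v` for all `v` of degree at most `p - 1`.
-/
theorem exists_sfh_of_rtH {p : ℕ} {τ : ℝ} {Fstar : Finset E3 → Finset E3}
    (hB : (T : Set E3) = Set.range B) (hF : (Fstar T : Set E3) = {B 0, B 1, B 2})
    (hFstar : Fstar T ∈ facesOf T) (hr : IsTrace T lam r) (hrp : r (Fstar T) ∈ vecPolySpace p)
    {s : LocalTriple} (hs : IsLocalSolution (rtH p) dt T lam s) :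
    ∃ u, IsLocalSolution (sfh p τ Fstar) dt T lam ⟨s.L, u, s.p⟩ ∧
      ∀ᵐ x ∂(surfaceMeasure.restrict (hull (Fstar T))), ∀ i, lam x i = pval (u i) x := by
  choose w hw h using fun i => exists_weighted_riesz (T := T) (ω := coordPoly B)
    (fun q hq => eq_zero_of_cellInt_coordPoly hB hq) ((p : ℤ) - 1)
    (formS T (s.u i - r (Fstar T) i))
  have hmem : (fun i => r (Fstar T) i + coordPoly B * w i) ∈ vecPolySpace p :=
    mem_vecPolySpace.2 fun i => by
      have := mul_mem_polySpace (coordPoly_mem B) (hw i)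
      rw [add_sub_cancel] at this
      exact Submodule.add_mem _ (mem_vecPolySpace.1 hrp i) this
  have hcoord : ∀ x ∈ hull (Fstar T), pval (coordPoly B) x = 0 := by
    intro x hx
    obtain ⟨y, -, rfl⟩ := hull_subset_image hF hx
    rw [pval_coordPoly]
    have hsub : hull (Fstar T) ⊆ {x | B.coord 3 x = 0} := by
      refine convexHull_min ?_ ((convex_singleton (0 : ℝ)).affine_preimage (B.coord 3))
      rw [hF]
      rintro _ (rfl | rfl | rfl) <;> exact B.coord_apply_ne (by decide)
    exact hsub hx
  have htrace : ∀ᵐ x ∂(surfaceMeasure.restrict (hull (Fstar T))),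
      ∀ i, lam x i = pval (r (Fstar T) i + coordPoly B * w i) x := by
    filter_upwards [hr _ hFstar, ae_restrict_mem (isCompact_hull (Fstar T)).measurableSet]
      with x hx hxF i
    rw [pval_add, pval_mul, hcoord x hxF, zero_mul, add_zero, hx]
  refine ⟨_, hs.transfer hB rfl rfl hmem (fun v hv => ?_) (fun F _ h0 => ?_), htrace⟩
  · rw [innerV_eq, innerV_eq]
    refine Finset.sum_congr rfl fun i _ => ?_
    have h1 := h i (v i) (mem_vecPolySpace.1 hv i)
    change _ = cellInt T ((s.u i - r (Fstar T) i) * v i) at h1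
    rw [add_mul, map_add, h1, sub_mul, map_sub]
    ring
  · obtain rfl : F = Fstar T := by
      by_contra hne
      exact h0 (by simp [sfh, hne])
    exact htrace

end Existence

/-! ### The local problems on the cells of a mesh -/

theorem TetMesh.exists_affineBasis {Ω : Set E3} (mesh : TetMesh Ω) {T F : Finset E3}
    (hT : T ∈ mesh.cells) (hF : F ∈ facesOf T) : ∃ B : AffineBasis (Fin 4) ℝ E3,
      (T : Set E3) = Set.range B ∧ (F : Set E3) = {B 0, B 1, B 2} := by
  obtain ⟨hT1, hT2⟩ := Finset.mem_filter.1 hT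
  exact StokesHDG.exists_affineBasis (mesh.complex.indep (mesh.finite.mem_toFinset.1 hT1)) hT2 hF

theorem TetMesh.faceIntegrable {Ω : Set E3} (mesh : TetMesh Ω) {T : Finset E3}
    (hT : T ∈ mesh.cells) : FaceIntegrable T := fun F hF q => by
  obtain ⟨B, -, hB⟩ := mesh.exists_affineBasis hT hF
  exact integrableOn_face hB q

theorem TetMesh.facesOf_subset {Ω : Set E3} (mesh : TetMesh Ω) {T : Finset E3}
    (hT : T ∈ mesh.cells) : facesOf T ⊆ mesh.faces := fun F hF => by
  obtain ⟨hsub, hcard⟩ := Finset.mem_powersetCard.1 hF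
  obtain ⟨hT1, -⟩ := Finset.mem_filter.1 hT
  refine Finset.mem_filter.2 ⟨mesh.finite.mem_toFinset.2 (mesh.complex.down_closed
    (mesh.finite.mem_toFinset.1 hT1) hsub (Finset.card_pos.1 (by omega))), hcard⟩

theorem TetMesh.exists_isTrace {Ω : Set E3} (mesh : TetMesh Ω) {p : ℕ}
    {lam : Lp E3 2 (surfaceMeasure.restrict mesh.skeleton)} (hlam : lam ∈ traceSpace mesh p)
    {T : Finset E3} (hT : T ∈ mesh.cells) :
    ∃ r : Finset E3 → Fin 3 → Poly3, IsTrace T lam r ∧ ∀ F ∈ facesOf T, r F ∈ vecPolySpace p := by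
  -- Stated for every `F`, with the value `0` away from the faces of `T`, so that the choice is a
  -- total function.
  have h : ∀ F, ∃ q : Fin 3 → Poly3, F ∈ facesOf T → q ∈ vecPolySpace p ∧
      ∀ᵐ x ∂(surfaceMeasure.restrict (hull F)), ∀ i, lam x i = pval (q i) x := fun F => by
    by_cases hF : F ∈ facesOf T
    · obtain ⟨q, hq, h⟩ := hlam.1 F (mesh.facesOf_subset hT hF)
      exact ⟨q, fun _ => ⟨hq, h⟩⟩
    · exact ⟨0, fun h => absurd h hF⟩
  choose r hr using h
  exact ⟨r, fun F hF => (hr F hF).2, fun F hF => (hr F hF).1⟩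

theorem IsLocalSolution.unique {m : Method} {dt : ℝ} {T : Finset E3} {lam : E3 → E3}
    {r : Finset E3 → Fin 3 → Poly3} {B : AffineBasis (Fin 4) ℝ E3}
    (hB : (T : Set E3) = Set.range B) (hT : FaceIntegrable T) (hr : IsTrace T lam r)
    (hdt : 0 < dt) (hm : ∀ F, 0 ≤ m.stab T F)
    (hu : ∀ s, IsLocalSolution m dt T 0 s → s.u = 0) {s t : LocalTriple}
    (hs : IsLocalSolution m dt T lam s) (ht : IsLocalSolution m dt T lam t) : s = t := by
  have h := hs.sub hT hr ht
  obtain ⟨hL, hp, -⟩ := h.homogeneous hB hT hdt hm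
  exact IsLocalSolution.eq_of_sub hL (hu _ h) hp

/-- Uniqueness identifies the arbitrary choice in `localSolver` with any solution at hand. -/
theorem localSolver_eq {m : Method} {dt : ℝ} {T : Finset E3} {lam : E3 → E3}
    (huniq : ∀ s t, IsLocalSolution m dt T lam s → IsLocalSolution m dt T lam t → s = t)
    {s : LocalTriple} (hs : IsLocalSolution m dt T lam s) : localSolver m dt T lam = s :=
  huniq _ _ (Classical.epsilon_spec ⟨s, hs⟩) hs

/-- The solutions of the three element-local problems on one cell. -/
theorem exists_localSolver_eq {Ω : Set E3} (mesh : TetMesh Ω) (p : ℕ) {dt : ℝ} (hdt : 0 < dt)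
    {τ : ℝ} (hτ : 0 < τ) {Fstar : Finset E3 → Finset E3}
    (hFstar : ∀ T ∈ mesh.cells, Fstar T ∈ facesOf T)
    {lam : Lp E3 2 (surfaceMeasure.restrict mesh.skeleton)} (hlam : lam ∈ traceSpace mesh p)
    {T : Finset E3} (hT : T ∈ mesh.cells) :
    (∀ m ∈ ({bdmH p, rtH p, sfh p τ Fstar} : Set Method),
      ∃! s : LocalTriple, IsLocalSolution m dt T lam s) ∧
    ∃ L q ub ur us, localSolver (bdmH p) dt T lam = ⟨L, ub, q⟩ ∧
      localSolver (rtH p) dt T lam = ⟨L, ur, q⟩ ∧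
      localSolver (sfh p τ Fstar) dt T lam = ⟨L, us, q⟩ ∧
      ∀ᵐ x ∂(surfaceMeasure.restrict (hull (Fstar T))), ∀ i, lam x i = pval (us i) x := by
  have hFT := hFstar T hT
  -- The marked face is taken to be `F*`, so `B.coord 3` vanishes on the stabilized face.
  obtain ⟨B, hB, hF⟩ := mesh.exists_affineBasis hT hFT
  have hint := mesh.faceIntegrable hT
  obtain ⟨r, hr, hrp⟩ := mesh.exists_isTrace hlam hT
  have hbu : ∀ s t, IsLocalSolution (bdmH p) dt T lam s → IsLocalSolution (bdmH p) dt T lam t →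
      s = t := fun s t => IsLocalSolution.unique hB hint hr hdt (fun _ => le_rfl) fun s hs =>
    hs.u_eq_zero hB hint hdt (fun _ => le_rfl) fun v hv => exists_divergence_eq_of_vecPolySpace hv
  have hru : ∀ s t, IsLocalSolution (rtH p) dt T lam s → IsLocalSolution (rtH p) dt T lam t →
      s = t := fun s t => IsLocalSolution.unique hB hint hr hdt (fun _ => le_rfl) fun s hs =>
    hs.u_eq_zero hB hint hdt (fun _ => le_rfl) fun v hv => exists_divergence_eq_of_raviartThomas hv
  have hsu : ∀ s t, IsLocalSolution (sfh p τ Fstar) dt T lam s →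
      IsLocalSolution (sfh p τ Fstar) dt T lam t → s = t := fun s t =>
    IsLocalSolution.unique hB hint hr hdt (sfh_stab_nonneg hτ Fstar T) fun s hs =>
      hs.u_eq_zero_sfh hB hF hint hdt hτ hFT
  obtain ⟨s, hs⟩ := exists_isLocalSolution_rtH p hdt hB hint hr
  obtain ⟨ub, hb⟩ := exists_bdmH_of_rtH hB hs
  obtain ⟨us, hsf, htr⟩ := exists_sfh_of_rtH (τ := τ) hB hF hFT hr (hrp _ hFT) hs
  refine ⟨?_, s.L, s.p, ub, s.u, us, localSolver_eq hbu hb, localSolver_eq hru hs,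
    localSolver_eq hsu hsf, htr⟩
  rintro m (rfl | rfl | rfl)
  · exact ⟨_, hb, fun t ht => hbu _ _ ht hb⟩
  · exact ⟨_, hs, fun t ht => hru _ _ ht hs⟩
  · exact ⟨_, hsf, fun t ht => hsu _ _ ht hsf⟩

end StokesHDG

end

/-! ### Assembly over the mesh -/

theorem mainTheorem3 {Ω : Set StokesHDG.E3} (mesh : StokesHDG.TetMesh Ω) (p : ℕ)
    (dt : ℝ) (hdt : 0 < dt) (τ : ℝ) (hτ : 0 < τ)
    (Fstar : Finset StokesHDG.E3 → Finset StokesHDG.E3)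
    (hFstar : ∀ T ∈ mesh.cells, Fstar T ∈ StokesHDG.facesOf T) :
    -- the element-local problems of all three methods are uniquely solvable
    (∀ m ∈ ({StokesHDG.bdmH p, StokesHDG.rtH p, StokesHDG.sfh p τ Fstar} : Set StokesHDG.Method),
      ∀ lam ∈ StokesHDG.traceSpace mesh p, ∀ T ∈ mesh.cells,
        ∃! s : StokesHDG.LocalTriple, StokesHDG.IsLocalSolution m dt T lam s) ∧
    -- the local solvers give the same gradient and the same pressure
    (∀ lam ∈ StokesHDG.traceSpace mesh p, ∀ T ∈ mesh.cells,
      (StokesHDG.localSolver (StokesHDG.bdmH p) dt T lam).L =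
        (StokesHDG.localSolver (StokesHDG.rtH p) dt T lam).L ∧
      (StokesHDG.localSolver (StokesHDG.rtH p) dt T lam).L =
        (StokesHDG.localSolver (StokesHDG.sfh p τ Fstar) dt T lam).L ∧
      (StokesHDG.localSolver (StokesHDG.bdmH p) dt T lam).p =
        (StokesHDG.localSolver (StokesHDG.rtH p) dt T lam).p ∧
      (StokesHDG.localSolver (StokesHDG.rtH p) dt T lam).p =
        (StokesHDG.localSolver (StokesHDG.sfh p τ Fstar) dt T lam).p) ∧
    -- the stabilization term vanishes
    (∀ m ∈ ({StokesHDG.bdmH p, StokesHDG.rtH p, StokesHDG.sfh p τ Fstar} : Set StokesHDG.Method),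
      ∀ lam ∈ StokesHDG.traceSpace mesh p, ∀ mu ∈ StokesHDG.traceSpace mesh p,
        StokesHDG.stabilizationTerm mesh m dt lam mu = 0) ∧
    -- the bilinear forms coincide
    (∀ lam ∈ StokesHDG.traceSpace mesh p, ∀ mu ∈ StokesHDG.traceSpace mesh p,
      StokesHDG.aForm mesh (StokesHDG.bdmH p) dt lam mu =
        StokesHDG.aForm mesh (StokesHDG.rtH p) dt lam mu ∧
      StokesHDG.aForm mesh (StokesHDG.rtH p) dt lam mu =
        StokesHDG.aForm mesh (StokesHDG.sfh p τ Fstar) dt lam mu) := by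
  have key := fun lam hlam T hT =>
    StokesHDG.exists_localSolver_eq mesh p hdt hτ hFstar (lam := lam) hlam (T := T) hT
  have hcoin : ∀ lam ∈ StokesHDG.traceSpace mesh p, ∀ T ∈ mesh.cells,
      (StokesHDG.localSolver (StokesHDG.bdmH p) dt T lam).L =
        (StokesHDG.localSolver (StokesHDG.rtH p) dt T lam).L ∧
      (StokesHDG.localSolver (StokesHDG.rtH p) dt T lam).L =
        (StokesHDG.localSolver (StokesHDG.sfh p τ Fstar) dt T lam).L ∧
      (StokesHDG.localSolver (StokesHDG.bdmH p) dt T lam).p =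
        (StokesHDG.localSolver (StokesHDG.rtH p) dt T lam).p ∧
      (StokesHDG.localSolver (StokesHDG.rtH p) dt T lam).p =
        (StokesHDG.localSolver (StokesHDG.sfh p τ Fstar) dt T lam).p := by
    intro lam hlam T hT
    obtain ⟨-, L, q, ub, ur, us, hb, hr, hs, -⟩ := key lam hlam T hT
    rw [hb, hr, hs]
    exact ⟨rfl, rfl, rfl, rfl⟩
  have hstab : ∀ m ∈ ({StokesHDG.bdmH p, StokesHDG.rtH p, StokesHDG.sfh p τ Fstar} :
      Set StokesHDG.Method), ∀ lam ∈ StokesHDG.traceSpace mesh p,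
      ∀ mu ∈ StokesHDG.traceSpace mesh p, StokesHDG.stabilizationTerm mesh m dt lam mu = 0 := by
    intro m hm lam hlam mu _
    refine Finset.sum_eq_zero fun T hT => StokesHDG.boundaryIntegral_eq_zero fun F _ => ?_
    rcases hm with rfl | rfl | rfl
    · exact .of_forall fun x => by simp [StokesHDG.bdmH]
    · exact .of_forall fun x => by simp [StokesHDG.rtH]
    · obtain ⟨-, L, q, ub, ur, us, -, -, hs, htr⟩ := key lam hlam T hT
      by_cases hF : F = Fstar T
      · rw [hF]
        -- On `F*` the SFH velocity for `lam` has trace `lam`, so the first factor of the integrand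
        -- vanishes.
        filter_upwards [htr] with x hx
        simp [hs, hx]
      · exact .of_forall fun x => by simp [StokesHDG.sfh, hF]
  refine ⟨fun m hm lam hlam T hT => (key lam hlam T hT).1 m hm, hcoin, hstab,
    fun lam hlam mu hmu => ?_⟩
  have hb := hstab _ (Or.inl rfl) lam hlam mu hmu
  have hr := hstab _ (Or.inr (Or.inl rfl)) lam hlam mu hmu
  have hs := hstab _ (Or.inr (Or.inr rfl)) lam hlam mu hmu
  -- Without stabilization the forms depend only on the gradients and pressures, which agree cell by
  -- cell.
  simp only [StokesHDG.aForm, hb, hr, hs, StokesHDG.gradientTerm, StokesHDG.pressureTerm]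
  constructor
  · congr 2
    · refine Finset.sum_congr rfl fun T hT => ?_
      rw [(hcoin lam hlam T hT).1, (hcoin mu hmu T hT).1]
    · refine Finset.sum_congr rfl fun T hT => ?_
      rw [(hcoin lam hlam T hT).2.2.1, (hcoin mu hmu T hT).2.2.1]
  · congr 2
    · refine Finset.sum_congr rfl fun T hT => ?_
      rw [(hcoin lam hlam T hT).2.1, (hcoin mu hmu T hT).2.1]
    · refine Finset.sum_congr rfl fun T hT => ?_
      rw [(hcoin lam hlam T hT).2.2.2, (hcoin mu hmu T hT).2.2.2]
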